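/- For an integer $n\ge 1$ let $\Omega(n)$ denote the number of prime factors of $n$ counted with multiplicity. For $k\ge 1$ and real $y\ge 1$ put $$f_k=\sum_{\Omega(n)=k}\frac{1}{n\log n},\qquad f_{k,y}=\sum_{\substack{\Omega(n)=k\\ p\mid n\Rightarrow p>y}}\frac{1}{n\log n},$$ where in the second sum every prime factor $p$ of $n$ is required to exceed $y$ (so $f_{k,1}=f_k$). These series converge for every $k\ge1$. Theorem. (i) There is $K\ge 2$ such that $f_{k-1}<f_k$ for all $k\ge K$. (ii) For every real $y\ge 2$ there is $K=K(y)\ge 2$ such that $f_{k-1,y}>f_{k,y}$ for all $k\ge K$. Thus, from some point on, $f_k$ is strictly increasing in $k$, contrary to the conjecture of Banks and Martin that $f_{k,y}$ decreases in $k$ for every $y\ge1$, whereas for each fixed $y\ge 2$ the sifted sums $f_{k,y}$ are strictly decreasing in $k$ for $k$ sufficiently large, as that conjecture predicts. -/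

import Mathlib

/-- The `k`-almost primes: the positive integers with exactly `k` prime factors, counted with
multiplicity. -/
def almostPrimes (k : ℕ) : Set ℕ :=
  {n : ℕ | 0 < n ∧ ArithmeticFunction.cardFactors n = k}

/-- The `k`-almost primes all of whose prime factors exceed `y`. -/
def siftedAlmostPrimes (k : ℕ) (y : ℝ) : Set ℕ :=
  {n : ℕ | n ∈ almostPrimes k ∧ ∀ p : ℕ, p.Prime → p ∣ n → y < (p : ℝ)}

/-- The term `1 / (n log n)` of the Erdős sums (used only at `n ≥ 2`, i.e. for `k ≥ 1`). -/
noncomputable def erdosTerm (n : ℕ) : ℝ := 1 / ((n : ℝ) * Real.log (n : ℝ))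

/-- The Erdős sum `f_k` of the `k`-almost primes. -/
noncomputable def erdosSum (k : ℕ) : ℝ := ∑' n : almostPrimes k, erdosTerm (n : ℕ)

/-- The sifted Erdős sum `f_{k,y}`. -/
noncomputable def siftedErdosSum (k : ℕ) (y : ℝ) : ℝ :=
  ∑' n : siftedAlmostPrimes k y, erdosTerm (n : ℕ)

open scoped ENNReal
open MeasureTheory Set

/-! Write P_k(s) for the Dirichlet series of the sifted k-almost primes, T_i(s) for the sum of log p
· p^(-is) over the primes p > y, and m_k for the integral of u P_k(1+u) over (0, η], with η small.
Since 1/(n log n) is the integral of n^(-1-u) over u > 0, the sum f_{k,y} is the integral of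
P_k(1+u) over (0, η] up to an error of at most 2 P_k(1+η). Logarithmic differentiation gives -P_k' =
∑ T_i P_{k-i}, so integration by parts turns the integral of P_k(1+u) into a boundary term plus the
integrals of u T_i(1+u) P_{k-i}(1+u), for 1 ≤ i ≤ k. As u T_1(1+u) = 1 - c u + o(u), the term i = 1
is nearly f_{k-1,y} - c m_{k-1}. The sign of f_{k,y} - f_{k-1,y} is thus decided by comparing c
m_{k-1} with ∑_{i ≥ 2} T_i(1) m_{k-i}.

The moments m_k decay essentially no faster than 2^(-k): integration by parts against u²/2 gives
m_{k-1} ≤ ρ m_k for any ρ > 2 and small η (`exists_firstMoment_le_mul_succ`). The boundary terms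
P_k(1+η) decay like z^(-k) for any z < q^(1+η), where q bounds the primes from below, hence are
negligible (`exists_mul_almostPrimeSeries_lt`).

For y ≥ 2 the comparison is numerical. Euler's constant together with the prime powers absent from
T_1 gives c > 3/2 (`exists_primeSeries_add_le_inv`), while ∑_{i ≥ 2} T_i(1) · 2.01^(i-1) ≤ 29/20
(`tsum_primeSeries_two_mul_pow_le`), the series converging because p ≥ 3. So the sums decrease
(`eventually_erdosENN_succ_lt`).

For y = 1 the prime 2 is resonant: T_i(1) ≥ 2^(-i) log 2 cancels the growth of m_{k-i}. Grouping
integers by their exact power of 2, the groups contribute nearly equally to m_n, so the first J of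
them make up at most half (`exists_two_mul_sum_dyadicMoment_le`). Each of the terms 2 ≤ i ≤ J + 1 is
then at least a fixed multiple of m_n; with J large their total exceeds any constant times m_n, and
the sums increase (`eventually_erdosENN_one_lt_succ`).

Everything takes values in [0, ∞], so differences appear as additive inequalities and finiteness
matters only when a term is cancelled. -/

/-- The primes exceeding `y`. -/
def siftedPrimes (y : ℝ) : Set ℕ := {p : ℕ | p.Prime ∧ y < (p : ℝ)}

/-- The Dirichlet series `∑ n ^ (-s)` over the sifted `k`-almost primes. -/
noncomputable def almostPrimeSeries (y : ℝ) (k : ℕ) (s : ℝ) : ℝ≥0∞ :=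
  ∑' n : siftedAlmostPrimes k y, ENNReal.ofReal (((n : ℕ) : ℝ) ^ (-s))

/-- The series `∑ g p * p ^ (-i s)` over the primes exceeding `y`. -/
noncomputable def primeSeries (g : ℕ → ℝ≥0∞) (y : ℝ) (i : ℕ) (s : ℝ) : ℝ≥0∞ :=
  ∑' p : siftedPrimes y, g p * ENNReal.ofReal (((p : ℕ) : ℝ) ^ (-s)) ^ i

/-- The weight `log` on the natural numbers, with values in `ℝ≥0∞`. -/
noncomputable def logWeight (n : ℕ) : ℝ≥0∞ := ENNReal.ofReal (Real.log n)

/-! ### Newton-type recurrences for the almost prime series -/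

theorem pow_mul_mem_siftedAlmostPrimes_iff {y : ℝ} {p : ℕ} (hp : p ∈ siftedPrimes y)
    {i k : ℕ} (hik : i ≤ k) (m : ℕ) :
    p ^ i * m ∈ siftedAlmostPrimes k y ↔ m ∈ siftedAlmostPrimes (k - i) y := by
  have hp0 := hp.1.pos
  by_cases hm : m = 0
  · subst hm; simp [siftedAlmostPrimes, almostPrimes]
  have hpi : p ^ i ≠ 0 := (pow_pos hp0 i).ne'
  simp only [siftedAlmostPrimes, almostPrimes, mem_ofPred_eq,
    ArithmeticFunction.cardFactors_mul hpi hm, ArithmeticFunction.cardFactors_apply_prime_pow hp.1]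
  constructor
  · rintro ⟨⟨h1, h2⟩, h3⟩
    exact ⟨⟨Nat.pos_of_ne_zero hm, by omega⟩, fun r hr hrm => h3 r hr (hrm.mul_left _)⟩
  · rintro ⟨⟨h1, h2⟩, h3⟩
    refine ⟨⟨by positivity, by omega⟩, fun r hr hrm => ?_⟩
    rcases (Nat.Prime.dvd_mul hr).1 hrm with h | h
    · rw [(Nat.prime_dvd_prime_iff_eq hr hp.1).1 (hr.dvd_of_dvd_pow h)]; exact hp.2
    · exact h3 r hr h

theorem tsum_sifted_dvd {y : ℝ} {p : ℕ} (hp : p ∈ siftedPrimes y) {i k : ℕ} (hik : i ≤ k)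
    (w : ℕ → ℝ≥0∞) :
    ∑' n : siftedAlmostPrimes k y, (if p ^ i ∣ (n : ℕ) then w n else 0) =
      ∑' m : siftedAlmostPrimes (k - i) y, w (p ^ i * m) := by
  have hpi : 0 < p ^ i := pow_pos hp.1.pos i
  let φ : siftedAlmostPrimes (k - i) y → siftedAlmostPrimes k y := fun m =>
    ⟨p ^ i * m, (pow_mul_mem_siftedAlmostPrimes_iff hp hik m).2 m.2⟩
  have hφ : Function.Injective φ := by
    intro a b h
    have h' : p ^ i * (a : ℕ) = p ^ i * b := congrArg Subtype.val h
    exact Subtype.ext (Nat.eq_of_mul_eq_mul_left hpi h')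
  rw [← hφ.tsum_eq]
  · simp [φ]
  · intro n hn
    have hd : p ^ i ∣ (n : ℕ) := by
      by_contra h
      simp [h] at hn
    obtain ⟨m, hm⟩ := hd
    refine ⟨⟨m, (pow_mul_mem_siftedAlmostPrimes_iff hp hik m).1 (hm ▸ n.2)⟩, ?_⟩
    exact Subtype.ext hm.symm

/-- The exponent of p in n counts the i ≥ 1 with p^i ∣ n, and it is at most Ω(n) = k. -/
theorem sum_factorization_mul_eq_tsum {y : ℝ} {k n : ℕ} (hn : n ∈ siftedAlmostPrimes k y)
    (g : ℕ → ℝ≥0∞) :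
    ∑ p ∈ n.primeFactors, (n.factorization p : ℝ≥0∞) * g p =
      ∑' p : siftedPrimes y, ∑ i ∈ Finset.Icc 1 k, if (p : ℕ) ^ i ∣ n then g p else 0 := by
  have hn0 : n ≠ 0 := hn.1.1.ne'
  have key : ∀ p : ℕ, p.Prime → (n.factorization p : ℝ≥0∞) * g p =
      ∑ i ∈ Finset.Icc 1 k, if p ^ i ∣ n then g p else 0 := by
    intro p hp
    have hle : n.factorization p ≤ k := by
      have := hn.1.2
      rw [ArithmeticFunction.cardFactors_eq_sum_factorization] at this
      rw [← this]
      by_cases h : p ∈ n.factorization.support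
      · exact Finset.single_le_sum (f := fun p => n.factorization p) (fun _ _ => Nat.zero_le _) h
      · simp [Finsupp.notMem_support_iff.1 h]
    rw [← Finset.sum_filter, Finset.sum_const, nsmul_eq_mul]
    congr 2
    have : (Finset.Icc 1 k).filter (fun i => p ^ i ∣ n) = Finset.Icc 1 (n.factorization p) := by
      ext i
      simp only [Finset.mem_filter, Finset.mem_Icc, hp.pow_dvd_iff_le_factorization hn0]
      omega
    rw [this]; simp
  rw [tsum_subtype (siftedPrimes y) (fun p => ∑ i ∈ Finset.Icc 1 k, if p ^ i ∣ n then g p else 0),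
    tsum_eq_sum (s := n.primeFactors)]
  · refine Finset.sum_congr rfl fun p hp => ?_
    have hp' := Nat.mem_primeFactors.1 hp
    rw [indicator_of_mem (show p ∈ siftedPrimes y from ⟨hp'.1, hn.2 p hp'.1 hp'.2.1⟩)]
    exact key p hp'.1
  · intro p hp
    by_cases h : p ∈ siftedPrimes y
    · rw [indicator_of_mem h, ← key p h.1]
      have : n.factorization p = 0 := by
        rw [← Finsupp.notMem_support_iff]; simpa using hp
      simp [this]
    · rw [indicator_of_notMem h]

/-- Expand the additive weight over pairs (p, i) with p^i ∣ n, exchange the sums, and write n = p^i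
m. The choice g = log gives the weight log n, hence -P_k'; the choice g = 1 gives the weight Ω(n) =
k, hence Newton's identity between power sums and complete homogeneous sums. -/
theorem tsum_additive_mul_rpow (g : ℕ → ℝ≥0∞) (y : ℝ) (k : ℕ) (s : ℝ) :
    ∑' n : siftedAlmostPrimes k y,
      (∑ p ∈ (n : ℕ).primeFactors, ((n : ℕ).factorization p : ℝ≥0∞) * g p) *
        ENNReal.ofReal (((n : ℕ) : ℝ) ^ (-s)) =
    ∑ i ∈ Finset.Icc 1 k, primeSeries g y i s * almostPrimeSeries y (k - i) s := by
  calc _ = ∑' n : siftedAlmostPrimes k y, ∑' p : siftedPrimes y, ∑ i ∈ Finset.Icc 1 k,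
        g p * (if (p : ℕ) ^ i ∣ (n : ℕ) then ENNReal.ofReal (((n : ℕ) : ℝ) ^ (-s)) else 0) := by
        refine tsum_congr fun n => ?_
        rw [sum_factorization_mul_eq_tsum n.2, ← ENNReal.tsum_mul_right]
        refine tsum_congr fun p => ?_
        rw [Finset.sum_mul]
        refine Finset.sum_congr rfl fun i _ => ?_
        split_ifs <;> simp
    _ = ∑' p : siftedPrimes y, ∑ i ∈ Finset.Icc 1 k, g p * ∑' n : siftedAlmostPrimes k y,
        (if (p : ℕ) ^ i ∣ (n : ℕ) then ENNReal.ofReal (((n : ℕ) : ℝ) ^ (-s)) else 0) := by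
        rw [ENNReal.tsum_comm]
        refine tsum_congr fun p => ?_
        rw [Summable.tsum_finsetSum (fun _ _ => ENNReal.summable)]
        exact Finset.sum_congr rfl fun i _ => ENNReal.tsum_mul_left
    _ = ∑' p : siftedPrimes y, ∑ i ∈ Finset.Icc 1 k,
        g p * ENNReal.ofReal (((p : ℕ) : ℝ) ^ (-s)) ^ i * almostPrimeSeries y (k - i) s := by
        refine tsum_congr fun p => Finset.sum_congr rfl fun i hi => ?_
        rw [tsum_sifted_dvd p.2 (Finset.mem_Icc.1 hi).2
          (fun n => ENNReal.ofReal ((n : ℝ) ^ (-s))), mul_assoc, almostPrimeSeries,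
          ← ENNReal.tsum_mul_left (a := ENNReal.ofReal (((p : ℕ) : ℝ) ^ (-s)) ^ i)]
        congr 1
        refine tsum_congr fun m => ?_
        rw [← ENNReal.ofReal_pow (by positivity), ← ENNReal.ofReal_mul (by positivity)]
        congr 1
        push_cast
        rw [Real.mul_rpow (by positivity) (by positivity), ← Real.rpow_natCast_mul (by positivity),
          mul_comm (i : ℝ), Real.rpow_mul_natCast (by positivity)]
    _ = _ := by
        rw [Summable.tsum_finsetSum (fun _ _ => ENNReal.summable)]
        exact Finset.sum_congr rfl fun i _ => ENNReal.tsum_mul_right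

theorem tsum_log_mul_rpow (y : ℝ) (k : ℕ) (s : ℝ) :
    ∑' n : siftedAlmostPrimes k y, logWeight n * ENNReal.ofReal (((n : ℕ) : ℝ) ^ (-s)) =
    ∑ i ∈ Finset.Icc 1 k, primeSeries logWeight y i s * almostPrimeSeries y (k - i) s := by
  rw [← tsum_additive_mul_rpow]
  refine tsum_congr fun n => ?_
  congr 1
  rw [logWeight, Real.log_nat_eq_sum_factorization, Finsupp.sum,
    ENNReal.ofReal_sum_of_nonneg (fun p _ => by positivity), Nat.support_factorization]
  refine Finset.sum_congr rfl fun p _ => ?_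
  rw [ENNReal.ofReal_mul (by positivity), ENNReal.ofReal_natCast, logWeight]

theorem natCast_mul_almostPrimeSeries (y : ℝ) (k : ℕ) (s : ℝ) :
    (k : ℝ≥0∞) * almostPrimeSeries y k s =
    ∑ i ∈ Finset.Icc 1 k, primeSeries 1 y i s * almostPrimeSeries y (k - i) s := by
  rw [← tsum_additive_mul_rpow, almostPrimeSeries, ← ENNReal.tsum_mul_left]
  refine tsum_congr fun n => ?_
  congr 1
  conv_lhs => rw [← n.2.1.2, ArithmeticFunction.cardFactors_eq_sum_factorization, Finsupp.sum]
  simp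

/-! ### Exponential decay in k at a fixed s > 1 -/

/-- If all earlier d_j z^j are at most C, the recurrence bounds k d_k z^k by C times the geometric
sum S z / (1 - r z). Once k exceeds that quantity the factor k absorbs it; the finitely many smaller
k are built into C. -/
theorem exists_le_mul_inv_pow_of_newton {d : ℕ → ℝ} (hd : ∀ k, 0 ≤ d k) {S r z : ℝ} (hS : 0 ≤ S)
    (hr : 0 ≤ r) (hz : 0 < z) (hrz : r * z < 1)
    (h : ∀ k : ℕ, k * d k ≤ ∑ i ∈ Finset.Icc 1 k, S * r ^ (i - 1) * d (k - i)) :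
    ∃ C : ℝ, 0 < C ∧ ∀ k, d k ≤ C * z⁻¹ ^ k := by
  set B : ℝ := S * z / (1 - r * z) with hB
  have h1 : 0 < 1 - r * z := by linarith
  have hB0 : 0 ≤ B := by positivity
  obtain ⟨K, hK⟩ := exists_nat_gt B
  set C : ℝ := 1 + ∑ j ∈ Finset.range K, d j * z ^ j with hC
  have hsum : 0 ≤ ∑ j ∈ Finset.range K, d j * z ^ j :=
    Finset.sum_nonneg fun j _ => mul_nonneg (hd j) (by positivity)
  have key : ∀ k, d k * z ^ k ≤ C := by
    intro k
    induction k using Nat.strong_induction_on with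
    | _ k ih =>
      by_cases hk : k < K
      · have := Finset.single_le_sum (f := fun j => d j * z ^ j)
          (fun j _ => mul_nonneg (hd j) (by positivity)) (Finset.mem_range.2 hk)
        linarith
      · have hkB : B < k := hK.trans_le (by exact_mod_cast not_lt.1 hk)
        have hk0 : (0 : ℝ) < k := hB0.trans_lt hkB
        have step : (k : ℝ) * (d k * z ^ k) ≤ k * C := by
          calc (k : ℝ) * (d k * z ^ k) = (k * d k) * z ^ k := by ring
            _ ≤ (∑ i ∈ Finset.Icc 1 k, S * r ^ (i - 1) * d (k - i)) * z ^ k := by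
              gcongr; exact h k
            _ = ∑ i ∈ Finset.Icc 1 k, S * z * (r * z) ^ (i - 1) * (d (k - i) * z ^ (k - i)) := by
              rw [Finset.sum_mul]
              refine Finset.sum_congr rfl fun i hi => ?_
              have hi' := Finset.mem_Icc.1 hi
              have : z ^ k = z * z ^ (i - 1) * z ^ (k - i) := by
                rw [← pow_succ', ← pow_add]; congr 1; omega
              rw [this, mul_pow]; ring
            _ ≤ ∑ i ∈ Finset.Icc 1 k, S * z * (r * z) ^ (i - 1) * C := by
              refine Finset.sum_le_sum fun i hi => ?_
              have hi' := Finset.mem_Icc.1 hi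
              gcongr
              exact ih _ (by omega)
            _ = S * z * C * ∑ i ∈ Finset.range k, (r * z) ^ i := by
              rw [Finset.range_eq_Ico, Finset.mul_sum, Finset.sum_Ico_eq_sum_range,
                ← Finset.Ico_add_one_right_eq_Icc, Finset.sum_Ico_eq_sum_range]
              refine Finset.sum_congr (by simp) fun i _ => ?_
              simp; ring
            _ ≤ S * z * C * (1 / (1 - r * z)) := by
              gcongr
              rw [one_div]
              rw [← tsum_geometric_of_lt_one (by positivity) hrz]
              exact (summable_geometric_of_lt_one (by positivity) hrz).sum_le_tsum _
                fun _ _ => by positivity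
            _ = B * C := by rw [hB]; ring
            _ ≤ k * C := by gcongr
        exact le_of_mul_le_mul_left step hk0
  refine ⟨C, by positivity, fun k => ?_⟩
  rw [inv_pow, ← div_eq_mul_inv, le_div_iff₀ (by positivity)]
  exact key k

theorem tsum_subtype_rpow_lt_top (A : Set ℕ) {s : ℝ} (hs : 1 < s) :
    ∑' n : A, ENNReal.ofReal (((n : ℕ) : ℝ) ^ (-s)) < ∞ := by
  have h := (Real.summable_nat_rpow (p := -s)).2 (by linarith)
  have h2 := (h.subtype A)
  have := ENNReal.ofReal_tsum_of_nonneg (f := fun n : A => ((n : ℕ) : ℝ) ^ (-s))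
    (fun n => by positivity) h2
  rw [← this]
  exact ENNReal.ofReal_lt_top

theorem almostPrimeSeries_lt_top (y : ℝ) (k : ℕ) {s : ℝ} (hs : 1 < s) :
    almostPrimeSeries y k s < ∞ := tsum_subtype_rpow_lt_top _ hs

theorem almostPrimeSeries_zero {y : ℝ} (s : ℝ) : almostPrimeSeries y 0 s = 1 := by
  have h : siftedAlmostPrimes 0 y = {1} := by
    ext n
    simp only [siftedAlmostPrimes, almostPrimes, mem_ofPred_eq, mem_singleton_iff]
    constructor
    · rintro ⟨⟨h1, h2⟩, -⟩
      rcases ArithmeticFunction.cardFactors_eq_zero_iff_eq_zero_or_one.1 h2 with h | h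
      · omega
      · exact h
    · rintro rfl
      refine ⟨by simp, fun p hp h => ?_⟩
      exact absurd (Nat.dvd_one.1 h) hp.one_lt.ne'
  rw [almostPrimeSeries, h, tsum_singleton (b := (1 : ℕ))
    (f := fun n => ENNReal.ofReal ((n : ℝ) ^ (-s)))]
  simp

theorem rpow_neg_antitone {n : ℕ} (hn : 0 < n) {s t : ℝ} (h : s ≤ t) :
    (n : ℝ) ^ (-t) ≤ (n : ℝ) ^ (-s) :=
  Real.rpow_le_rpow_of_exponent_le (by exact_mod_cast hn) (by linarith)

theorem primeSeries_antitone (g : ℕ → ℝ≥0∞) (y : ℝ) (i : ℕ) : Antitone (primeSeries g y i) := by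
  intro s t h
  refine ENNReal.tsum_le_tsum fun p => ?_
  have := rpow_neg_antitone p.2.1.pos h
  gcongr _ * ENNReal.ofReal ?_ ^ _

theorem primeSeries_anti_left (g : ℕ → ℝ≥0∞) {x y : ℝ} (h : x ≤ y) (i : ℕ) (s : ℝ) :
    primeSeries g y i s ≤ primeSeries g x i s :=
  ENNReal.tsum_mono_subtype (fun p => g p * ENNReal.ofReal ((p : ℝ) ^ (-s)) ^ i)
    fun _ hp => ⟨hp.1, h.trans_lt hp.2⟩

theorem primeSeries_succ_le {y : ℝ} {q : ℕ} (hq0 : 0 < q) (hq : ∀ p ∈ siftedPrimes y, q ≤ p)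
    (g : ℕ → ℝ≥0∞) (i j : ℕ) {s : ℝ} (hs : 0 ≤ s) :
    primeSeries g y (i + j) s ≤ ENNReal.ofReal ((q : ℝ) ^ (-s)) ^ j * primeSeries g y i s := by
  rw [primeSeries, primeSeries, ← ENNReal.tsum_mul_left]
  refine ENNReal.tsum_le_tsum fun p => ?_
  have : (p : ℝ) ^ (-s) ≤ (q : ℝ) ^ (-s) :=
    Real.rpow_le_rpow_of_nonpos (by positivity) (by exact_mod_cast hq p p.2) (by linarith)
  rw [pow_add, ← mul_assoc, mul_comm]
  gcongr

/-- In Newton's identity the i-th power sum is at most q^(-s(i-1)) times the first, so the decay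
rate is governed by the lower bound q for the primes. -/
theorem exists_almostPrimeSeries_le {y : ℝ} {q : ℕ} (hq0 : 0 < q)
    (hq : ∀ p ∈ siftedPrimes y, q ≤ p) {s z : ℝ} (hs : 1 < s) (hz : 0 < z) (hzq : z < (q : ℝ) ^ s) :
    ∃ C : ℝ, 0 < C ∧ ∀ k, almostPrimeSeries y k s ≤ ENNReal.ofReal (C * z⁻¹ ^ k) := by
  have hfin := fun k => (almostPrimeSeries_lt_top y k hs).ne
  have hS : primeSeries 1 y 1 s < ∞ := by
    have := tsum_subtype_rpow_lt_top (siftedPrimes y) hs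
    simpa [primeSeries] using this
  have hr : (q : ℝ) ^ (-s) * z < 1 := by
    rw [Real.rpow_neg (by positivity), inv_mul_lt_iff₀ (by positivity)]; linarith
  obtain ⟨C, hC, h⟩ := exists_le_mul_inv_pow_of_newton
    (d := fun k => (almostPrimeSeries y k s).toReal) (fun k => ENNReal.toReal_nonneg)
    (S := (primeSeries 1 y 1 s).toReal) (r := (q : ℝ) ^ (-s)) (z := z) ENNReal.toReal_nonneg
    (by positivity) hz hr (by
      intro k
      have hle : (k : ℝ≥0∞) * almostPrimeSeries y k s ≤ ∑ i ∈ Finset.Icc 1 k,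
          primeSeries 1 y 1 s * ENNReal.ofReal ((q : ℝ) ^ (-s)) ^ (i - 1) *
            almostPrimeSeries y (k - i) s := by
        rw [natCast_mul_almostPrimeSeries]
        refine Finset.sum_le_sum fun i hi => ?_
        have hi' := Finset.mem_Icc.1 hi
        have := primeSeries_succ_le hq0 hq 1 1 (i - 1) (s := s) (by linarith)
        rw [show 1 + (i - 1) = i by omega] at this
        rw [mul_comm (primeSeries 1 y 1 s)]
        gcongr
      have hne : ∀ i ∈ Finset.Icc 1 k, primeSeries 1 y 1 s *
          ENNReal.ofReal ((q : ℝ) ^ (-s)) ^ (i - 1) * almostPrimeSeries y (k - i) s ≠ ∞ :=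
        fun i _ => ENNReal.mul_ne_top (ENNReal.mul_ne_top hS.ne (by finiteness)) (hfin _)
      have := ENNReal.toReal_mono (ENNReal.sum_ne_top.2 hne) hle
      rw [ENNReal.toReal_mul, ENNReal.toReal_sum hne] at this
      simpa [ENNReal.toReal_mul, ENNReal.toReal_ofReal (Real.rpow_nonneg (Nat.cast_nonneg q) _)]
        using this)
  refine ⟨C, hC, fun k => ?_⟩
  rw [ENNReal.le_ofReal_iff_toReal_le (hfin k) (by positivity)]
  exact h k

/-! ### Erdős sums as integrals, and integration by parts -/

/-- The sifted Erdős sum with values in `ℝ≥0∞`. -/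
noncomputable def erdosENN (y : ℝ) (k : ℕ) : ℝ≥0∞ :=
  ∑' n : siftedAlmostPrimes k y, ENNReal.ofReal (erdosTerm n)

theorem measurable_almostPrimeSeries (y : ℝ) (k : ℕ) :
    Measurable fun u : ℝ => almostPrimeSeries y k (1 + u) := by
  unfold almostPrimeSeries
  refine Measurable.tsum fun n => ?_
  fun_prop

theorem measurable_primeSeries (g : ℕ → ℝ≥0∞) (y : ℝ) (i : ℕ) :
    Measurable fun u : ℝ => primeSeries g y i (1 + u) := by
  unfold primeSeries
  refine Measurable.tsum fun n => ?_
  fun_prop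

theorem hasDerivAt_rpow_neg_one_add {n : ℕ} (hn : 0 < n) (u : ℝ) :
    HasDerivAt (fun u : ℝ => (n : ℝ) ^ (-(1 + u))) (-(Real.log n * (n : ℝ) ^ (-(1 + u)))) u := by
  have h1 : HasDerivAt (fun u : ℝ => -(1 + u)) (-1) u :=
    ((hasDerivAt_id u).const_add 1).fun_neg
  have hn' : (0 : ℝ) < n := by exact_mod_cast hn
  convert h1.const_rpow hn' using 1
  ring

theorem lintegral_mul_rpow_by_parts {n : ℕ} (hn : 0 < n) {η : ℝ} (hη : 0 ≤ η) {φ ψ : ℝ → ℝ}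
    (hφ : ∀ u, HasDerivAt φ (ψ u) u) (hψ : Continuous ψ) (hφ0 : φ 0 = 0)
    (hφn : ∀ u, 0 ≤ u → 0 ≤ φ u) (hψn : ∀ u, 0 ≤ u → 0 ≤ ψ u) :
    ∫⁻ u in Ioc 0 η, ENNReal.ofReal (ψ u) * ENNReal.ofReal ((n : ℝ) ^ (-(1 + u))) =
      ENNReal.ofReal (φ η) * ENNReal.ofReal ((n : ℝ) ^ (-(1 + η))) +
      ∫⁻ u in Ioc 0 η, ENNReal.ofReal (φ u) *
        (logWeight n * ENNReal.ofReal ((n : ℝ) ^ (-(1 + u)))) := by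
  have hn' : (0 : ℝ) < n := by exact_mod_cast hn
  have hL : 0 ≤ Real.log n := Real.log_natCast_nonneg n
  have cφ : Continuous φ := continuous_iff_continuousAt.2 fun u => (hφ u).continuousAt
  have cf : Continuous fun u : ℝ => (n : ℝ) ^ (-(1 + u)) :=
    continuous_iff_continuousAt.2 fun u => (hasDerivAt_rpow_neg_one_add hn u).continuousAt
  have conv : ∀ h : ℝ → ℝ, Continuous h → (∀ u, 0 ≤ u → 0 ≤ h u) →
      ∫⁻ u in Ioc 0 η, ENNReal.ofReal (h u) = ENNReal.ofReal (∫ u in (0:ℝ)..η, h u) := by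
    intro h hc h0
    rw [intervalIntegral.integral_of_le hη, ofReal_integral_eq_lintegral_ofReal]
    · exact (hc.integrableOn_Icc (a := 0) (b := η)).mono_set Ioc_subset_Icc_self
    · filter_upwards [ae_restrict_mem measurableSet_Ioc] with u hu
      exact h0 u hu.1.le
  have e1 : ∫⁻ u in Ioc 0 η, ENNReal.ofReal (ψ u) * ENNReal.ofReal ((n : ℝ) ^ (-(1 + u))) =
      ENNReal.ofReal (∫ u in (0:ℝ)..η, ψ u * (n : ℝ) ^ (-(1 + u))) := by
    rw [← conv (fun u => ψ u * (n : ℝ) ^ (-(1 + u))) (hψ.mul cf)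
      fun u hu => mul_nonneg (hψn u hu) (by positivity)]
    exact lintegral_congr fun u => (ENNReal.ofReal_mul' (by positivity)).symm
  have e2 : ∫⁻ u in Ioc 0 η, ENNReal.ofReal (φ u) *
        (logWeight n * ENNReal.ofReal ((n : ℝ) ^ (-(1 + u)))) =
      ENNReal.ofReal (∫ u in (0:ℝ)..η, φ u * (Real.log n * (n : ℝ) ^ (-(1 + u)))) := by
    rw [← conv (fun u => φ u * (Real.log n * (n : ℝ) ^ (-(1 + u))))
      (cφ.mul (continuous_const.mul cf)) fun u hu => mul_nonneg (hφn u hu) (by positivity)]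
    refine lintegral_congr fun u => ?_
    rw [logWeight, ENNReal.ofReal_mul' (by positivity), ENNReal.ofReal_mul hL]
  have i1 : IntervalIntegrable (fun u => ψ u * (n : ℝ) ^ (-(1 + u))) volume 0 η :=
    (hψ.mul cf).intervalIntegrable _ _
  have i2 : IntervalIntegrable (fun u => φ u * (Real.log n * (n : ℝ) ^ (-(1 + u)))) volume 0 η :=
    (cφ.mul (continuous_const.mul cf)).intervalIntegrable _ _
  have ftc : ∫ u in (0:ℝ)..η, (ψ u * (n : ℝ) ^ (-(1 + u)) -
      φ u * (Real.log n * (n : ℝ) ^ (-(1 + u)))) = φ η * (n : ℝ) ^ (-(1 + η)) := by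
    rw [intervalIntegral.integral_eq_sub_of_hasDerivAt
      (f := fun u => φ u * (n : ℝ) ^ (-(1 + u))) (fun u _ => ?_) (i1.sub i2), hφ0]
    · ring
    · simpa [sub_eq_add_neg] using (hφ u).fun_mul (hasDerivAt_rpow_neg_one_add hn u)
  rw [intervalIntegral.integral_sub i1 i2] at ftc
  rw [e1, e2, ← ENNReal.ofReal_mul (hφn η hη), ← ENNReal.ofReal_add
    (mul_nonneg (hφn η hη) (by positivity)), ← ftc, sub_add_cancel]
  exact intervalIntegral.integral_nonneg hη fun u hu =>
    mul_nonneg (hφn u hu.1) (by positivity)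

/-- Integrating by parts term by term over n avoids differentiating the series; the resulting weight
log n is expanded by `tsum_log_mul_rpow`. It is used with φ = u for the Erdős sums and φ = u²/2 for
the first moments. -/
theorem lintegral_almostPrimeSeries_by_parts (y : ℝ) (k : ℕ) {η : ℝ} (hη : 0 ≤ η) {φ ψ : ℝ → ℝ}
    (hφ : ∀ u, HasDerivAt φ (ψ u) u) (hψ : Continuous ψ) (hφ0 : φ 0 = 0)
    (hφn : ∀ u, 0 ≤ u → 0 ≤ φ u) (hψn : ∀ u, 0 ≤ u → 0 ≤ ψ u) :
    ∫⁻ u in Ioc 0 η, ENNReal.ofReal (ψ u) * almostPrimeSeries y k (1 + u) =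
      ENNReal.ofReal (φ η) * almostPrimeSeries y k (1 + η) +
      ∑ i ∈ Finset.Icc 1 k, ∫⁻ u in Ioc 0 η, ENNReal.ofReal (φ u) *
        (primeSeries logWeight y i (1 + u) * almostPrimeSeries y (k - i) (1 + u)) := by
  have cφ : Continuous φ := continuous_iff_continuousAt.2 fun u => (hφ u).continuousAt
  have mφ : Measurable fun u => ENNReal.ofReal (φ u) := cφ.measurable.ennreal_ofReal
  have mψ : Measurable fun u => ENNReal.ofReal (ψ u) := hψ.measurable.ennreal_ofReal
  have mf : ∀ n : ℕ, Measurable fun u : ℝ => ENNReal.ofReal ((n : ℝ) ^ (-(1 + u))) :=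
    fun n => by fun_prop
  have mT : ∀ i ∈ Finset.Icc 1 k, Measurable fun u => ENNReal.ofReal (φ u) *
      (primeSeries logWeight y i (1 + u) * almostPrimeSeries y (k - i) (1 + u)) :=
    fun i _ => mφ.mul ((measurable_primeSeries _ _ _).mul (measurable_almostPrimeSeries _ _))
  rw [← lintegral_finsetSum _ mT]
  simp_rw [← Finset.mul_sum, ← tsum_log_mul_rpow, almostPrimeSeries, ← ENNReal.tsum_mul_left]
  rw [lintegral_tsum (fun n => by fun_prop), lintegral_tsum (fun n => by fun_prop),
    ← ENNReal.tsum_add]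
  exact tsum_congr fun n => lintegral_mul_rpow_by_parts n.2.1.1 hη hφ hψ hφ0 hφn hψn

theorem lintegral_rpow_add_eq_erdosTerm {n : ℕ} (hn : 2 ≤ n) {η : ℝ} (hη : 0 ≤ η) :
    ENNReal.ofReal (erdosTerm n) = (∫⁻ u in Ioc 0 η, ENNReal.ofReal ((n : ℝ) ^ (-(1 + u)))) +
      ENNReal.ofReal ((n : ℝ) ^ (-(1 + η)) / Real.log n) := by
  have hn' : (0 : ℝ) < n := by positivity
  have hL : 0 < Real.log n := Real.log_pos (by exact_mod_cast hn)
  have cf : Continuous fun u : ℝ => (n : ℝ) ^ (-(1 + u)) :=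
    continuous_iff_continuousAt.2 fun u =>
      (hasDerivAt_rpow_neg_one_add (by omega) u).continuousAt
  have ftc : ∫ u in (0:ℝ)..η, (n : ℝ) ^ (-(1 + u)) =
      -((n : ℝ) ^ (-(1 + η)) / Real.log n) + erdosTerm n := by
    rw [intervalIntegral.integral_eq_sub_of_hasDerivAt
      (f := fun u => -((n : ℝ) ^ (-(1 + u)) / Real.log n)) (fun u _ => ?_)
      (cf.intervalIntegrable _ _)]
    · simp [erdosTerm, Real.rpow_neg_one]
      field_simp
    · convert ((hasDerivAt_rpow_neg_one_add (n := n) (by omega) u).div_const (Real.log n)).fun_neg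
        using 1
      field_simp
  have : ∫⁻ u in Ioc 0 η, ENNReal.ofReal ((n : ℝ) ^ (-(1 + u))) =
      ENNReal.ofReal (∫ u in (0:ℝ)..η, (n : ℝ) ^ (-(1 + u))) := by
    rw [intervalIntegral.integral_of_le hη, ofReal_integral_eq_lintegral_ofReal]
    · exact (cf.integrableOn_Icc (a := 0) (b := η)).mono_set Ioc_subset_Icc_self
    · exact Filter.Eventually.of_forall fun u => by positivity
  rw [this, ← ENNReal.ofReal_add, ftc]
  · congr 1; ring
  · exact intervalIntegral.integral_nonneg hη fun u _ => by positivity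
  · positivity

theorem two_le_of_mem_siftedAlmostPrimes {y : ℝ} {k n : ℕ} (hk : 1 ≤ k)
    (hn : n ∈ siftedAlmostPrimes k y) : 2 ≤ n := by
  have h1 := hn.1.1
  by_contra h
  obtain rfl : n = 1 := by omega
  have := hn.1.2
  simp at this
  omega

theorem lintegral_almostPrimeSeries_le_erdosENN (y : ℝ) {k : ℕ} (hk : 1 ≤ k) {η : ℝ} (hη : 0 ≤ η) :
    ∫⁻ u in Ioc 0 η, almostPrimeSeries y k (1 + u) ≤ erdosENN y k := by
  unfold almostPrimeSeries
  rw [lintegral_tsum (fun n => by fun_prop)]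
  refine ENNReal.tsum_le_tsum fun n => ?_
  rw [lintegral_rpow_add_eq_erdosTerm (two_le_of_mem_siftedAlmostPrimes hk n.2) hη]
  exact le_self_add

theorem erdosENN_le_lintegral_add (y : ℝ) {k : ℕ} (hk : 1 ≤ k) {η : ℝ} (hη : 0 ≤ η) :
    erdosENN y k ≤ (∫⁻ u in Ioc 0 η, almostPrimeSeries y k (1 + u)) +
      2 * almostPrimeSeries y k (1 + η) := by
  unfold almostPrimeSeries erdosENN
  rw [lintegral_tsum (fun n => by fun_prop), ← ENNReal.tsum_mul_left, ← ENNReal.tsum_add]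
  refine ENNReal.tsum_le_tsum fun n => ?_
  have h2 := two_le_of_mem_siftedAlmostPrimes hk n.2
  rw [lintegral_rpow_add_eq_erdosTerm h2 hη]
  gcongr
  rw [← ENNReal.ofReal_ofNat 2, ← ENNReal.ofReal_mul (by norm_num)]
  refine ENNReal.ofReal_le_ofReal ?_
  -- The factor 2 in the tail bound comes from log n ≥ log 2 > 1/2.
  have hL : 1 / 2 ≤ Real.log (n : ℕ) := by
    have h3 : Real.log 2 ≤ Real.log (n : ℕ) := Real.log_le_log (by norm_num) (by exact_mod_cast h2)
    have := Real.log_two_gt_d9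
    linarith
  have : 0 ≤ ((n : ℕ) : ℝ) ^ (-(1 + η)) := by positivity
  rw [div_le_iff₀ (by linarith)]
  nlinarith

/-! ### The prime sum near s = 1 -/

/-- The Dirichlet series of the von Mangoldt function at `1 + u`. -/
noncomputable def vonMangoldtSeries (u : ℝ) : ℝ≥0∞ :=
  ∑' n : ℕ, ENNReal.ofReal (ArithmeticFunction.vonMangoldt n * (n : ℝ) ^ (-(1 + u)))

theorem vonMangoldtSeries_eq {u : ℝ} (hu : 0 < u) :
    vonMangoldtSeries u =
      ENNReal.ofReal (-deriv riemannZeta (1 + u) / riemannZeta (1 + u)).re := by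
  have hs : 1 < (1 + u : ℂ).re := by simpa using hu
  have hsum := ArithmeticFunction.LSeriesSummable_vonMangoldt hs
  have hterm : ∀ n : ℕ, LSeries.term (fun n => (ArithmeticFunction.vonMangoldt n : ℂ)) (1 + u) n =
      ((ArithmeticFunction.vonMangoldt n * (n : ℝ) ^ (-(1 + u)) : ℝ) : ℂ) := by
    intro n
    rcases eq_or_ne n 0 with rfl | hn
    · simp
    · rw [LSeries.term_of_ne_zero hn, div_eq_mul_inv, Real.rpow_neg (by positivity)]
      push_cast
      rw [Complex.ofReal_cpow (by positivity)]
      simp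
  have hsum' : Summable fun n : ℕ =>
      ArithmeticFunction.vonMangoldt n * (n : ℝ) ^ (-(1 + u)) := by
    rw [← Complex.summable_ofReal]
    exact hsum.congr fun n => hterm n
  rw [← ArithmeticFunction.LSeries_vonMangoldt_eq_deriv_riemannZeta_div hs, LSeries,
    tsum_congr hterm, ← Complex.ofReal_tsum, Complex.ofReal_re,
    ENNReal.ofReal_tsum_of_nonneg (fun n => mul_nonneg
      ArithmeticFunction.vonMangoldt_nonneg (by positivity)) hsum', vonMangoldtSeries]

theorem vonMangoldtSeries_lt_top {u : ℝ} (hu : 0 < u) : vonMangoldtSeries u < ∞ := by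
  rw [vonMangoldtSeries_eq hu]; exact ENNReal.ofReal_lt_top

open Filter Topology in
theorem tendsto_inv_sub_vonMangoldtSeries :
    Tendsto (fun u : ℝ => 1 / u - (-deriv riemannZeta (1 + u) / riemannZeta (1 + u)).re)
      (𝓝[>] 0) (𝓝 Real.eulerMascheroniConstant) := by
  have h1 := log_deriv_riemannZeta_add_inv_sub_sub_isLittleO
  rw [Asymptotics.isLittleO_one_iff] at h1
  have h2 : Tendsto (fun u : ℝ => (1 + u : ℂ)) (𝓝[>] 0) (𝓝[≠] 1) := by
    refine tendsto_nhdsWithin_iff.2 ⟨?_, ?_⟩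
    · have : Continuous fun u : ℝ => (1 + u : ℂ) := by fun_prop
      simpa using (this.tendsto 0).mono_left nhdsWithin_le_nhds
    · filter_upwards [self_mem_nhdsWithin] with u hu
      have : u ≠ 0 := (show (0:ℝ) < u from hu).ne'
      simpa using this
  have h3 := (Complex.continuous_re.tendsto _).comp (h1.comp h2)
  have h4 := h3.add_const Real.eulerMascheroniConstant
  simp only [Complex.zero_re, zero_add] at h4
  refine h4.congr fun u => ?_
  have : ((u : ℂ)⁻¹).re = u⁻¹ := by rw [← Complex.ofReal_inv, Complex.ofReal_re]
  simp [neg_div, this]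
  ring

open Filter Topology in
-- The difference 1/u - (-ζ'/ζ)(1+u) tends to Euler's constant, which lies strictly between 1/2 and
-- 1.
theorem exists_vonMangoldtSeries_bounds : ∃ η : ℝ, 0 < η ∧ ∀ u, 0 < u → u ≤ η →
    vonMangoldtSeries u + ENNReal.ofReal (1 / 2) ≤ ENNReal.ofReal (1 / u) ∧
    ENNReal.ofReal (1 / u) ≤ vonMangoldtSeries u + 1 := by
  have h := tendsto_inv_sub_vonMangoldtSeries
  have h1 := h.eventually (lt_mem_nhds Real.one_half_lt_eulerMascheroniConstant)
  have h2 := h.eventually (gt_mem_nhds (Real.eulerMascheroniConstant_lt_two_thirds.trans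
    (show (2 / 3 : ℝ) < 1 by norm_num)))
  obtain ⟨η, hη, H⟩ := mem_nhdsGT_iff_exists_Ioc_subset.1 (h1.and h2)
  refine ⟨η, hη, fun u hu huη => ?_⟩
  obtain ⟨a, b⟩ := H ⟨hu, huη⟩
  rw [vonMangoldtSeries_eq hu]
  set x := (-deriv riemannZeta (1 + u) / riemannZeta (1 + u)).re
  refine ⟨?_, ?_⟩
  · rcases le_total 0 x with hx | hx
    · rw [← ENNReal.ofReal_add hx (by norm_num)]
      exact ENNReal.ofReal_le_ofReal (by linarith)
    -- This case cannot occur: truncation at 0 would make the series vanish, but its term at n = 2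
    -- is positive.
    · rw [ENNReal.ofReal_of_nonpos hx, zero_add]
      refine ENNReal.ofReal_le_ofReal ?_
      have : vonMangoldtSeries u = 0 := by
        rw [vonMangoldtSeries_eq hu, ENNReal.ofReal_of_nonpos hx]
      rw [vonMangoldtSeries, ENNReal.tsum_eq_zero] at this
      have h2 := ENNReal.ofReal_eq_zero.1 (this 2)
      have h3 : 0 < ArithmeticFunction.vonMangoldt 2 * ((2 : ℕ) : ℝ) ^ (-(1 + u)) := by
        rw [ArithmeticFunction.vonMangoldt_apply_prime Nat.prime_two]
        have := Real.log_pos (show (1 : ℝ) < 2 by norm_num)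
        push_cast
        positivity
      linarith
  · calc ENNReal.ofReal (1 / u) ≤ ENNReal.ofReal (x + 1) := ENNReal.ofReal_le_ofReal (by linarith)
      _ ≤ ENNReal.ofReal x + ENNReal.ofReal 1 := ENNReal.ofReal_add_le
      _ = _ := by simp

theorem vonMangoldtSeries_eq_tsum_primeSeries (u : ℝ) :
    vonMangoldtSeries u = ∑' j : ℕ, primeSeries logWeight 1 (j + 1) (1 + u) := by
  have h1 : vonMangoldtSeries u = ∑' n : {n : ℕ // IsPrimePow n},
      ENNReal.ofReal (ArithmeticFunction.vonMangoldt n * ((n : ℕ) : ℝ) ^ (-(1 + u))) := by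
    rw [vonMangoldtSeries]
    refine (tsum_subtype_eq_of_support_subset (s := {n | IsPrimePow n}) fun n hn => ?_).symm
    by_contra h
    have := ArithmeticFunction.vonMangoldt_eq_zero_iff.2 h
    simp [this] at hn
  have h2 : siftedPrimes 1 = {p | p.Prime} := by
    ext p
    simp only [siftedPrimes, mem_ofPred_eq, and_iff_left_iff_imp]
    exact fun h => by exact_mod_cast h.one_lt
  rw [h1, ← Nat.Primes.prodNatEquiv.tsum_eq, ENNReal.tsum_prod', ENNReal.tsum_comm]
  refine tsum_congr fun j => ?_
  rw [primeSeries, h2]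
  refine tsum_congr fun p => ?_
  have hp : Nat.Prime p := p.2
  rw [Nat.Primes.coe_prodNatEquiv_apply, ArithmeticFunction.vonMangoldt_apply_pow (by omega),
    ArithmeticFunction.vonMangoldt_apply_prime hp, ENNReal.ofReal_mul (Real.log_natCast_nonneg _),
    logWeight, ← ENNReal.ofReal_pow (by positivity)]
  congr 2
  push_cast
  rw [← Real.rpow_natCast_mul (by positivity), mul_comm, Real.rpow_mul_natCast (by positivity)]

theorem primeSeries_one_one_le_vonMangoldtSeries (u : ℝ) :
    primeSeries logWeight 1 1 (1 + u) ≤ vonMangoldtSeries u := by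
  rw [vonMangoldtSeries_eq_tsum_primeSeries]
  exact ENNReal.le_tsum (f := fun j => primeSeries logWeight 1 (j + 1) (1 + u)) 0

theorem siftedPrimes_two_le {y : ℝ} : ∀ p ∈ siftedPrimes y, 2 ≤ p := fun _ hp => hp.1.two_le

theorem siftedPrimes_three_le {y : ℝ} (hy : 2 ≤ y) : ∀ p ∈ siftedPrimes y, 3 ≤ p := by
  intro p hp
  have : (2 : ℝ) < p := hy.trans_lt hp.2
  exact_mod_cast this

theorem primeSeries_log_one_lt_top {y u : ℝ} (hy : 1 ≤ y) (hu : 0 < u) :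
    primeSeries logWeight y 1 (1 + u) < ∞ :=
  ((primeSeries_anti_left _ hy _ _).trans (primeSeries_one_one_le_vonMangoldtSeries u)).trans_lt
    (vonMangoldtSeries_lt_top hu)

theorem primeSeries_log_two_one_lt_top {y : ℝ} (hy : 1 ≤ y) : primeSeries logWeight y 2 1 < ∞ := by
  have : primeSeries logWeight y 2 1 = primeSeries logWeight y 1 (1 + 1) := by
    refine tsum_congr fun p => ?_
    rw [← ENNReal.ofReal_pow (by positivity), pow_one, ← Real.rpow_mul_natCast (by positivity)]
    norm_num
  rw [this]
  exact primeSeries_log_one_lt_top hy one_pos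

theorem exists_tsum_primeSeries_add_two_le : ∃ C : ℝ, 0 ≤ C ∧ ∀ u, 0 ≤ u →
    ∑' j : ℕ, primeSeries logWeight 1 (j + 2) (1 + u) ≤ ENNReal.ofReal C := by
  have hfin := primeSeries_log_two_one_lt_top le_rfl
  refine ⟨(2 * primeSeries logWeight 1 2 1).toReal, ENNReal.toReal_nonneg, fun u hu => ?_⟩
  rw [ENNReal.ofReal_toReal (by finiteness), ← ENNReal.tsum_geometric_two, ← ENNReal.tsum_mul_right]
  refine ENNReal.tsum_le_tsum fun j => ?_
  rw [add_comm]
  calc primeSeries logWeight 1 (2 + j) (1 + u) ≤ primeSeries logWeight 1 (2 + j) 1 :=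
        primeSeries_antitone _ _ _ (by linarith)
    _ ≤ ENNReal.ofReal (((2 : ℕ) : ℝ) ^ (-(1:ℝ))) ^ j * primeSeries logWeight 1 2 1 :=
        primeSeries_succ_le two_pos siftedPrimes_two_le _ _ _ zero_le_one
    _ = _ := by
        congr 2
        rw [Real.rpow_neg_one, ENNReal.ofReal_inv_of_pos (by norm_num)]
        simp

theorem exists_primeSeries_le_add (y : ℝ) : ∃ C : ℝ, 0 ≤ C ∧ ∀ u, 0 ≤ u →
    primeSeries logWeight 1 1 (1 + u) ≤ primeSeries logWeight y 1 (1 + u) + ENNReal.ofReal C := by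
  classical
  refine ⟨∑ p ∈ Finset.range (⌊y⌋₊ + 1), Real.log p,
    Finset.sum_nonneg fun p _ => Real.log_natCast_nonneg p, fun u hu => ?_⟩
  set f : ℕ → ℝ≥0∞ := fun p => logWeight p * ENNReal.ofReal ((p : ℝ) ^ (-(1 + u))) ^ 1
  have hsub : siftedPrimes 1 ⊆ siftedPrimes y ∪ (Finset.range (⌊y⌋₊ + 1) : Set ℕ) ∩ {p | 0 < p} := by
    intro p hp
    by_cases h : y < p
    · exact Or.inl ⟨hp.1, h⟩
    · refine Or.inr ⟨?_, hp.1.pos⟩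
      simp only [Finset.coe_range, mem_Iio]
      exact Nat.lt_succ_of_le (Nat.le_floor (not_lt.1 h))
  refine (ENNReal.tsum_mono_subtype f hsub).trans ((ENNReal.tsum_union_le f _ _).trans ?_)
  refine add_le_add le_rfl ?_
  calc ∑' p : ↥((Finset.range (⌊y⌋₊ + 1) : Set ℕ) ∩ {p | 0 < p}), f p
      ≤ ∑' p : ↥((Finset.range (⌊y⌋₊ + 1) : Set ℕ) ∩ {p | 0 < p}), logWeight p := by
        refine ENNReal.tsum_le_tsum fun p => ?_
        have hp : 1 ≤ (p : ℕ) := p.2.2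
        have : ENNReal.ofReal (((p : ℕ) : ℝ) ^ (-(1 + u))) ≤ 1 := by
          rw [ENNReal.ofReal_le_one]
          exact Real.rpow_le_one_of_one_le_of_nonpos (by exact_mod_cast hp) (by linarith)
        simpa [f] using mul_le_of_le_one_right zero_le this
    _ ≤ ∑' p : (Finset.range (⌊y⌋₊ + 1) : Set ℕ), logWeight p :=
        ENNReal.tsum_mono_subtype _ inter_subset_left
    _ = _ := by
        rw [Finset.tsum_subtype' (Finset.range (⌊y⌋₊ + 1)) logWeight,
          ENNReal.ofReal_sum_of_nonneg fun p _ => Real.log_natCast_nonneg p]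
        rfl

/-- This is T_1(1+u) ≥ 1/u - C, multiplied by u and rearranged to avoid subtraction. -/
theorem exists_one_le_mul_primeSeries_add (y : ℝ) : ∃ C : ℝ, 0 < C ∧ ∀ u, 0 < u → u ≤ 1 →
    1 ≤ ENNReal.ofReal u * primeSeries logWeight y 1 (1 + u) + ENNReal.ofReal (C * u) := by
  obtain ⟨C₁, hC₁, h₁⟩ := exists_tsum_primeSeries_add_two_le
  obtain ⟨C₂, hC₂, h₂⟩ := exists_primeSeries_le_add y
  obtain ⟨η, hη, hZ⟩ := exists_vonMangoldtSeries_bounds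
  -- The losses are: higher prime powers, primes up to `y`, the bound 1 for Euler's constant, and
  -- the range u > η, where 1/u ≤ 1/η suffices.
  set C := C₁ + C₂ + 1 + 1 / η
  have hC : 0 < C := by positivity
  refine ⟨C, hC, fun u hu hu1 => ?_⟩
  have key : ENNReal.ofReal (1 / u) ≤ primeSeries logWeight y 1 (1 + u) + ENNReal.ofReal C := by
    rcases le_total u η with h | h
    · calc ENNReal.ofReal (1 / u) ≤ vonMangoldtSeries u + 1 := (hZ u hu h).2
        _ = primeSeries logWeight 1 1 (1 + u) +
            ∑' j : ℕ, primeSeries logWeight 1 (j + 2) (1 + u) + 1 := by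
          rw [vonMangoldtSeries_eq_tsum_primeSeries, tsum_eq_zero_add' ENNReal.summable]
        _ ≤ primeSeries logWeight y 1 (1 + u) + ENNReal.ofReal C₂ + ENNReal.ofReal C₁ + 1 := by
          gcongr
          · exact h₂ u hu.le
          · exact h₁ u hu.le
        _ = primeSeries logWeight y 1 (1 + u) + ENNReal.ofReal (C₂ + C₁ + 1) := by
          rw [ENNReal.ofReal_add (by positivity) (by positivity), ENNReal.ofReal_add hC₂ hC₁,
            ENNReal.ofReal_one]
          ring
        _ ≤ _ := by
          gcongr
          have : 0 ≤ 1 / η := by positivity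
          linarith
    · refine le_add_left (ENNReal.ofReal_le_ofReal ?_)
      have : 1 / u ≤ 1 / η := one_div_le_one_div_of_le hη h
      linarith
  calc (1 : ℝ≥0∞) = ENNReal.ofReal u * ENNReal.ofReal (1 / u) := by
        rw [← ENNReal.ofReal_mul hu.le, mul_one_div_cancel hu.ne', ENNReal.ofReal_one]
    _ ≤ ENNReal.ofReal u * (primeSeries logWeight y 1 (1 + u) + ENNReal.ofReal C) := by gcongr
    _ = _ := by rw [mul_add, ← ENNReal.ofReal_mul hu.le, mul_comm u C]

theorem exists_mul_primeSeries_le {y : ℝ} (hy : 1 ≤ y) : ∃ C : ℝ≥0∞, C < ∞ ∧ ∀ u, 0 < u → u ≤ 1 →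
    ENNReal.ofReal u * primeSeries logWeight y 1 (1 + u) ≤ C := by
  obtain ⟨η, hη, hZ⟩ := exists_vonMangoldtSeries_bounds
  refine ⟨1 + primeSeries logWeight y 1 (1 + η),
    ENNReal.add_lt_top.2 ⟨ENNReal.one_lt_top, primeSeries_log_one_lt_top hy hη⟩,
    fun u hu hu1 => ?_⟩
  rcases le_total u η with h | h
  · refine le_add_right ?_
    calc _ ≤ ENNReal.ofReal u * ENNReal.ofReal (1 / u) := by
          gcongr
          exact (primeSeries_anti_left _ hy _ _).trans
            ((primeSeries_one_one_le_vonMangoldtSeries u).trans (le_self_add.trans (hZ u hu h).1))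
      _ = 1 := by rw [← ENNReal.ofReal_mul hu.le, mul_one_div_cancel hu.ne', ENNReal.ofReal_one]
  · refine le_add_left ?_
    calc _ ≤ 1 * primeSeries logWeight y 1 (1 + η) := by
          gcongr
          · exact ENNReal.ofReal_le_one.2 hu1
          · exact primeSeries_antitone _ _ _ (by linarith)
      _ = _ := one_mul _

/-! ### The numerical constants 3/2 and 29/20 -/

theorem log_le_of_pow_le_two_pow {n a b : ℕ} (hn : 0 < n) (ha : 0 < a) (h : n ^ a ≤ 2 ^ b) :
    Real.log n ≤ b / a * 0.6931471808 := by
  have h1 : Real.log ((n : ℝ) ^ a) ≤ Real.log ((2 : ℝ) ^ b) :=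
    Real.log_le_log (by positivity) (by exact_mod_cast h)
  rw [Real.log_pow, Real.log_pow] at h1
  have h2 := Real.log_two_lt_d9
  have ha' : (0 : ℝ) < a := by exact_mod_cast ha
  rw [div_mul_eq_mul_div, le_div_iff₀ ha', mul_comm]
  exact h1.trans (by gcongr)

theorem le_log_of_two_pow_le_pow {n a b : ℕ} (ha : 0 < a) (h : 2 ^ b ≤ n ^ a) :
    b / a * 0.6931471803 ≤ Real.log n := by
  have h1 : Real.log ((2 : ℝ) ^ b) ≤ Real.log ((n : ℝ) ^ a) :=
    Real.log_le_log (by positivity) (by exact_mod_cast h)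
  rw [Real.log_pow, Real.log_pow] at h1
  have h2 := Real.log_two_gt_d9
  have ha' : (0 : ℝ) < a := by exact_mod_cast ha
  rw [div_mul_eq_mul_div, div_le_iff₀ ha', mul_comm (Real.log n)]
  refine le_trans ?_ h1
  gcongr

/-- Prime powers not counted by the primes above `2`. -/
def smallPrimePowers : Finset ℕ :=
  {2, 4, 8, 16, 32, 64, 128, 9, 27, 81, 243, 25, 125, 49, 343, 121, 169}

theorem vonMangoldt_of_eq_pow {n p j : ℕ} (hp : p.Prime) (hj : j ≠ 0) (h : n = p ^ j) :
    ArithmeticFunction.vonMangoldt n = Real.log p := by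
  rw [h, ArithmeticFunction.vonMangoldt_apply_pow hj, ArithmeticFunction.vonMangoldt_apply_prime hp]

/-- The powers of 2 give about 0.69 and the odd prime powers about 0.34. Exceeding 1 is what lifts
the bound 1/2 for Euler's constant to 3/2. -/
theorem one_lt_sum_smallPrimePowers :
    1 < ∑ n ∈ smallPrimePowers, ArithmeticFunction.vonMangoldt n * (n : ℝ) ^ (-(1 + 0 : ℝ)) := by
  have v2 : ∀ j n : ℕ, j ≠ 0 → n = 2 ^ j → ArithmeticFunction.vonMangoldt n = Real.log 2 :=
    fun j n hj h => by exact_mod_cast vonMangoldt_of_eq_pow Nat.prime_two hj h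
  have v3 : ∀ j n : ℕ, j ≠ 0 → n = 3 ^ j → ArithmeticFunction.vonMangoldt n = Real.log 3 :=
    fun j n hj h => by exact_mod_cast vonMangoldt_of_eq_pow Nat.prime_three hj h
  have v5 : ∀ j n : ℕ, j ≠ 0 → n = 5 ^ j → ArithmeticFunction.vonMangoldt n = Real.log 5 :=
    fun j n hj h => by exact_mod_cast vonMangoldt_of_eq_pow Nat.prime_five hj h
  have v7 : ∀ j n : ℕ, j ≠ 0 → n = 7 ^ j → ArithmeticFunction.vonMangoldt n = Real.log 7 :=
    fun j n hj h => by exact_mod_cast vonMangoldt_of_eq_pow (p := 7) (by norm_num) hj h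
  have l2 := Real.log_two_gt_d9
  have l3 := le_log_of_two_pow_le_pow (n := 3) (a := 12) (b := 19) (by norm_num) (by norm_num)
  have l5 := le_log_of_two_pow_le_pow (n := 5) (a := 4) (b := 9) (by norm_num) (by norm_num)
  have l7 := le_log_of_two_pow_le_pow (n := 7) (a := 5) (b := 14) (by norm_num) (by norm_num)
  have l11 := le_log_of_two_pow_le_pow (n := 11) (a := 3) (b := 10) (by norm_num) (by norm_num)
  have l13 := le_log_of_two_pow_le_pow (n := 13) (a := 3) (b := 11) (by norm_num) (by norm_num)
  have e11 := vonMangoldt_of_eq_pow (n := 121) (p := 11) (j := 2) (by norm_num) (by norm_num)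
    (by norm_num)
  have e13 := vonMangoldt_of_eq_pow (n := 169) (p := 13) (j := 2) (by norm_num) (by norm_num)
    (by norm_num)
  simp only [add_zero, Real.rpow_neg_one]
  simp only [smallPrimePowers]
  repeat rw [Finset.sum_insert (by decide)]
  rw [Finset.sum_singleton, v2 1 2 (by decide) (by norm_num), v2 2 4 (by decide) (by norm_num),
    v2 3 8 (by decide) (by norm_num), v2 4 16 (by decide) (by norm_num),
    v2 5 32 (by decide) (by norm_num), v2 6 64 (by decide) (by norm_num),
    v2 7 128 (by decide) (by norm_num), v3 2 9 (by decide) (by norm_num),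
    v3 3 27 (by decide) (by norm_num), v3 4 81 (by decide) (by norm_num),
    v3 5 243 (by decide) (by norm_num), v5 2 25 (by decide) (by norm_num),
    v5 3 125 (by decide) (by norm_num), v7 2 49 (by decide) (by norm_num),
    v7 3 343 (by decide) (by norm_num), e11, e13]
  push_cast at *
  norm_num at *
  linarith

theorem primeSeries_two_add_sum_le_vonMangoldtSeries (u : ℝ) :
    primeSeries logWeight 2 1 (1 + u) + ∑ n ∈ smallPrimePowers,
      ENNReal.ofReal (ArithmeticFunction.vonMangoldt n * (n : ℝ) ^ (-(1 + u))) ≤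
      vonMangoldtSeries u := by
  set f : ℕ → ℝ≥0∞ := fun n =>
    ENNReal.ofReal (ArithmeticFunction.vonMangoldt n * (n : ℝ) ^ (-(1 + u))) with hf
  have h1 : primeSeries logWeight 2 1 (1 + u) = ∑' n, (siftedPrimes 2).indicator f n := by
    rw [← tsum_subtype]
    refine tsum_congr fun p => ?_
    rw [hf, pow_one, logWeight, ← ENNReal.ofReal_mul (Real.log_natCast_nonneg _)]
    simp only
    rw [ArithmeticFunction.vonMangoldt_apply_prime p.2.1]
  have h2 : ∑ n ∈ smallPrimePowers, f n = ∑' n, (smallPrimePowers : Set ℕ).indicator f n := by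
    rw [← tsum_subtype, Finset.tsum_subtype' smallPrimePowers f]
  have hdisj : ∀ n ∈ smallPrimePowers, n ∉ siftedPrimes 2 := by
    intro n hn h
    have h' : n.Prime ∧ 2 < n := ⟨h.1, by exact_mod_cast h.2⟩
    revert hn h'
    simp only [smallPrimePowers, Finset.mem_insert, Finset.mem_singleton]
    rintro (rfl | rfl | rfl | rfl | rfl | rfl | rfl | rfl | rfl | rfl | rfl | rfl | rfl | rfl |
      rfl | rfl | rfl) <;> norm_num
  rw [h1, h2, ← ENNReal.tsum_add]
  refine ENNReal.tsum_le_tsum fun n => ?_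
  by_cases hn : n ∈ smallPrimePowers
  · rw [indicator_of_notMem (hdisj n hn), zero_add]
    exact indicator_le_self' (fun _ _ => zero_le) n
  · rw [indicator_of_notMem (s := (smallPrimePowers : Set ℕ)) (by simpa using hn), add_zero]
    exact indicator_le_self' (fun _ _ => zero_le) n

open Filter Topology in
/-- Near `u = 0` the prime sum lies below `1 / u` by more than `3 / 2`. -/
theorem exists_primeSeries_add_le_inv : ∃ η : ℝ, 0 < η ∧ ∀ y : ℝ, 2 ≤ y → ∀ u, 0 < u → u ≤ η →
    primeSeries logWeight y 1 (1 + u) + ENNReal.ofReal (3 / 2) ≤ ENNReal.ofReal (1 / u) := by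
  obtain ⟨η₁, hη₁, hZ⟩ := exists_vonMangoldtSeries_bounds
  have hcont : Continuous fun u : ℝ => ∑ n ∈ smallPrimePowers,
      ArithmeticFunction.vonMangoldt n * (n : ℝ) ^ (-(1 + u)) := by
    refine continuous_finsetSum _ fun n hn => continuous_const.mul ?_
    have hn0 : 0 < n := by
      by_contra h
      obtain rfl : n = 0 := by omega
      exact absurd hn (by decide)
    exact continuous_iff_continuousAt.2 fun u => (hasDerivAt_rpow_neg_one_add hn0 u).continuousAt
  have hev := (hcont.tendsto 0).eventually (lt_mem_nhds one_lt_sum_smallPrimePowers)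
  obtain ⟨η₂, hη₂, H⟩ := mem_nhdsGT_iff_exists_Ioc_subset.1 (hev.filter_mono
    (nhdsWithin_le_nhds (s := Ioi (0 : ℝ))))
  refine ⟨min η₁ η₂, lt_min hη₁ hη₂, fun y hy u hu huη => ?_⟩
  have h1 : (1 : ℝ≥0∞) ≤ ∑ n ∈ smallPrimePowers,
      ENNReal.ofReal (ArithmeticFunction.vonMangoldt n * (n : ℝ) ^ (-(1 + u))) := by
    rw [← ENNReal.ofReal_sum_of_nonneg fun n _ =>
      mul_nonneg ArithmeticFunction.vonMangoldt_nonneg (by positivity), ENNReal.one_le_ofReal]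
    exact (show (1:ℝ) < _ from H ⟨hu, huη.trans (min_le_right _ _)⟩).le
  calc primeSeries logWeight y 1 (1 + u) + ENNReal.ofReal (3 / 2)
      = primeSeries logWeight y 1 (1 + u) + 1 + ENNReal.ofReal (1 / 2) := by
        rw [show (3 / 2 : ℝ) = 1 + 1 / 2 by norm_num,
          ENNReal.ofReal_add zero_le_one (by norm_num), ENNReal.ofReal_one, add_assoc]
    _ ≤ primeSeries logWeight 2 1 (1 + u) + (∑ n ∈ smallPrimePowers,
        ENNReal.ofReal (ArithmeticFunction.vonMangoldt n * (n : ℝ) ^ (-(1 + u)))) +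
        ENNReal.ofReal (1 / 2) := by
        gcongr
        exact primeSeries_anti_left _ hy _ _
    _ ≤ vonMangoldtSeries u + ENNReal.ofReal (1 / 2) := by
        gcongr
        exact primeSeries_two_add_sum_le_vonMangoldtSeries u
    _ ≤ _ := (hZ u hu (huη.trans (min_le_left _ _))).1

/-- The sum of `log p * p ^ (-j) * ρ ^ (j - 1)` over `j ≥ 2`, for `ρ = 201 / 100`. -/
noncomputable def higherPowerWeight (x : ℝ) : ℝ := Real.log x * 2.01 / (x * (x - 2.01))

theorem higherPowerWeight_nonneg {x : ℝ} (hx : 3 ≤ x) : 0 ≤ higherPowerWeight x := by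
  have : 0 ≤ Real.log x := Real.log_nonneg (by linarith)
  unfold higherPowerWeight
  have : 0 < x * (x - 2.01) := by nlinarith
  positivity

/-- A telescoping majorant with step 2, made for a sum over odd integers. Replacing x(x - 2.01) by
the smaller (x - 3)(x - 1) produces differences of 1/(x - 3), with 1.005 = 2.01/2; the term +1
beside log x absorbs the increment log(x + 2) - log x ≤ 2/x. -/
theorem higherPowerWeight_le_sub {x : ℝ} (hx : 17 ≤ x) :
    higherPowerWeight x ≤ 1.005 * (Real.log x + 1) / (x - 3) -
      1.005 * (Real.log (x + 2) + 1) / (x + 2 - 3) := by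
  have hx0 : 0 < x := by linarith
  have hL : 0 ≤ Real.log x := Real.log_nonneg (by linarith)
  have h1 : Real.log (x + 2) ≤ Real.log x + 2 / x := by
    have : Real.log ((x + 2) / x) ≤ (x + 2) / x - 1 :=
      Real.log_le_sub_one_of_pos (by positivity)
    rw [Real.log_div (by linarith) hx0.ne', add_div, div_self hx0.ne'] at this
    linarith
  have h2 : 1.005 * (Real.log (x + 2) + 1) / (x + 2 - 3) ≤
      1.005 * (Real.log x + 2 / x + 1) / (x + 2 - 3) := by
    have : 0 < x + 2 - 3 := by linarith
    gcongr
  have h3 : higherPowerWeight x ≤ Real.log x * 2.01 / ((x - 3) * (x - 1)) := by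
    unfold higherPowerWeight
    have : 0 < (x - 3) * (x - 1) := mul_pos (by linarith) (by linarith)
    refine div_le_div_of_nonneg_left (by positivity) this ?_
    nlinarith
  have h4 : 1.005 * (Real.log x + 1) / (x - 3) - 1.005 * (Real.log x + 2 / x + 1) / (x + 2 - 3) -
      Real.log x * 2.01 / ((x - 3) * (x - 1)) = 6.03 / (x * (x - 3) * (x - 1)) := by
    have a1 : x - 3 ≠ 0 := by linarith
    have a2 : x - 1 ≠ 0 := by linarith
    rw [show x + 2 - 3 = x - 1 by ring]
    field_simp
    ring
  have h5 : 0 ≤ 6.03 / (x * (x - 3) * (x - 1)) := by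
    have : 0 < x * (x - 3) * (x - 1) := mul_pos (mul_pos hx0 (by linarith)) (by linarith)
    positivity
  linarith

theorem tsum_higherPowerWeight_odd_le :
    ∑' m : ℕ, ENNReal.ofReal (higherPowerWeight ((17 + 2 * m : ℕ) : ℝ)) ≤
      ENNReal.ofReal (1.005 * (Real.log 17 + 1) / 14) := by
  have hnn : ∀ m : ℕ, 0 ≤ higherPowerWeight ((17 + 2 * m : ℕ) : ℝ) := fun m =>
    higherPowerWeight_nonneg (by push_cast; linarith [(Nat.cast_nonneg m : (0:ℝ) ≤ m)])
  have key : ∀ N : ℕ, ∑ m ∈ Finset.range N, higherPowerWeight ((17 + 2 * m : ℕ) : ℝ) ≤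
      1.005 * (Real.log 17 + 1) / 14 -
        1.005 * (Real.log (17 + 2 * N) + 1) / (17 + 2 * N - 3) := by
    intro N
    induction N with
    | zero => simp; norm_num
    | succ N ih =>
      rw [Finset.sum_range_succ]
      have := higherPowerWeight_le_sub (x := ((17 + 2 * N : ℕ) : ℝ))
        (by push_cast; linarith [(Nat.cast_nonneg N : (0:ℝ) ≤ N)])
      push_cast at this ih ⊢
      rw [show (17 : ℝ) + 2 * (N + 1) = 17 + 2 * N + 2 by ring]
      linarith
  rw [ENNReal.tsum_eq_iSup_nat]
  refine iSup_le fun N => ?_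
  rw [← ENNReal.ofReal_sum_of_nonneg fun m _ => hnn m]
  refine ENNReal.ofReal_le_ofReal ((key N).trans (sub_le_self _ ?_))
  have : 0 ≤ Real.log (17 + 2 * (N : ℝ)) :=
    Real.log_nonneg (by linarith [(Nat.cast_nonneg N : (0:ℝ) ≤ N)])
  have : 0 ≤ 17 + 2 * (N : ℝ) - 3 := by linarith [(Nat.cast_nonneg N : (0:ℝ) ≤ N)]
  positivity

theorem sum_higherPowerWeight_le :
    ∑ p ∈ ({3, 5, 7, 11, 13} : Finset ℕ), higherPowerWeight p +
      1.005 * (Real.log 17 + 1) / 14 ≤ 29 / 20 := by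
  have l3 := log_le_of_pow_le_two_pow (n := 3) (a := 17) (b := 27)
    (by norm_num) (by norm_num) (by norm_num)
  have l5 := log_le_of_pow_le_two_pow (n := 5) (a := 3) (b := 7)
    (by norm_num) (by norm_num) (by norm_num)
  have l7 := log_le_of_pow_le_two_pow (n := 7) (a := 6) (b := 17)
    (by norm_num) (by norm_num) (by norm_num)
  have l11 := log_le_of_pow_le_two_pow (n := 11) (a := 2) (b := 7)
    (by norm_num) (by norm_num) (by norm_num)
  have l13 := log_le_of_pow_le_two_pow (n := 13) (a := 4) (b := 15)
    (by norm_num) (by norm_num) (by norm_num)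
  have l17 := log_le_of_pow_le_two_pow (n := 17) (a := 10) (b := 41)
    (by norm_num) (by norm_num) (by norm_num)
  repeat rw [Finset.sum_insert (by decide)]
  rw [Finset.sum_singleton]
  unfold higherPowerWeight
  push_cast at *
  norm_num at *
  linarith

theorem siftedPrimes_two_subset :
    siftedPrimes 2 ⊆ (({3, 5, 7, 11, 13} : Finset ℕ) : Set ℕ) ∪ range fun m : ℕ => 17 + 2 * m := by
  intro p hp
  have h2 : 2 < p := by exact_mod_cast hp.2
  have hodd : p % 2 = 1 := (Nat.Prime.eq_two_or_odd hp.1).resolve_left (by omega)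
  by_cases h : 17 ≤ p
  · exact Or.inr ⟨(p - 17) / 2, by simp only; omega⟩
  · have hp1 := hp.1
    left
    interval_cases p <;> first | omega | (simp; done) | (exfalso; revert hp1; norm_num)

/-- Summing the geometric series for each prime gives `higherPowerWeight`. The primes 3 to 13 are
evaluated individually, and the later ones are enlarged to all odd integers from 17 on. -/
theorem tsum_primeSeries_two_mul_pow_le :
    ∑' j : ℕ, primeSeries logWeight 2 (j + 2) 1 * ENNReal.ofReal 2.01 ^ (j + 1) ≤
      ENNReal.ofReal (29 / 20) := by
  have h1 : ∑' j : ℕ, primeSeries logWeight 2 (j + 2) 1 * ENNReal.ofReal 2.01 ^ (j + 1) =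
      ∑' p : siftedPrimes 2, ENNReal.ofReal (higherPowerWeight (p : ℕ)) := by
    simp_rw [primeSeries, ← ENNReal.tsum_mul_right]
    rw [ENNReal.tsum_comm]
    refine tsum_congr fun p => ?_
    have hp : (3 : ℝ) ≤ (p : ℕ) := by exact_mod_cast siftedPrimes_three_le le_rfl p p.2
    have hp0 : (0 : ℝ) < (p : ℕ) := by linarith
    have hr1 : 2.01 / ((p : ℕ) : ℝ) < 1 := by rw [div_lt_one hp0]; linarith
    have hr0 : 0 ≤ 2.01 / ((p : ℕ) : ℝ) := by positivity
    have hL := Real.log_natCast_nonneg (p : ℕ)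
    have hterm : ∀ j : ℕ, logWeight p * ENNReal.ofReal (((p : ℕ) : ℝ) ^ (-(1:ℝ))) ^ (j + 2) *
        ENNReal.ofReal 2.01 ^ (j + 1) = ENNReal.ofReal
          (Real.log (p : ℕ) * 2.01 / ((p : ℕ) : ℝ) ^ 2 * (2.01 / ((p : ℕ) : ℝ)) ^ j) := by
      intro j
      rw [logWeight, ← ENNReal.ofReal_pow (by positivity), ← ENNReal.ofReal_pow (by positivity),
        ← ENNReal.ofReal_mul hL, ← ENNReal.ofReal_mul (by positivity), Real.rpow_neg_one]
      congr 1
      rw [div_pow, inv_pow, pow_add, pow_succ 2.01]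
      field_simp
    rw [tsum_congr hterm, ← ENNReal.ofReal_tsum_of_nonneg (fun j => by positivity)
      ((summable_geometric_of_lt_one hr0 hr1).mul_left _), tsum_mul_left,
      tsum_geometric_of_lt_one hr0 hr1]
    congr 1
    unfold higherPowerWeight
    have : ((p : ℕ) : ℝ) - 2.01 ≠ 0 := by linarith
    have : (1 - 2.01 / ((p : ℕ) : ℝ)) = (((p : ℕ) : ℝ) - 2.01) / (p : ℕ) := by field_simp
    rw [this]
    field_simp
  have hnn : ∀ p ∈ ({3, 5, 7, 11, 13} : Finset ℕ), 0 ≤ higherPowerWeight p := by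
    intro p hp
    apply higherPowerWeight_nonneg
    revert hp
    simp only [Finset.mem_insert, Finset.mem_singleton]
    rintro (rfl | rfl | rfl | rfl | rfl) <;> norm_num
  rw [h1]
  refine (ENNReal.tsum_mono_subtype (fun p : ℕ => ENNReal.ofReal (higherPowerWeight p))
    siftedPrimes_two_subset).trans ((ENNReal.tsum_union_le
      (fun p : ℕ => ENNReal.ofReal (higherPowerWeight p)) _ _).trans ?_)
  rw [Finset.tsum_subtype' _ (fun p : ℕ => ENNReal.ofReal (higherPowerWeight p)),
    ← ENNReal.ofReal_sum_of_nonneg hnn,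
    tsum_range (g := fun m : ℕ => 17 + 2 * m) (fun p : ℕ => ENNReal.ofReal (higherPowerWeight p))
      (fun a b h => by simpa using h)]
  refine (add_le_add le_rfl tsum_higherPowerWeight_odd_le).trans ?_
  rw [← ENNReal.ofReal_add (Finset.sum_nonneg hnn)
    (by have := Real.log_nonneg (show (1 : ℝ) ≤ 17 by norm_num); positivity)]
  exact ENNReal.ofReal_le_ofReal sum_higherPowerWeight_le

theorem sum_primeSeries_mul_pow_le {y : ℝ} (hy : 2 ≤ y) (k : ℕ) :
    ∑ i ∈ Finset.Icc 2 k, primeSeries logWeight y i 1 * ENNReal.ofReal 2.01 ^ (i - 1) ≤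
      ENNReal.ofReal (29 / 20) := by
  refine le_trans ?_ tsum_primeSeries_two_mul_pow_le
  rw [← Finset.Ico_add_one_right_eq_Icc, Finset.sum_Ico_eq_sum_range]
  refine le_trans (Finset.sum_le_sum fun j _ => ?_) (ENNReal.sum_le_tsum (Finset.range (k + 1 - 2)))
  rw [add_comm 2 j, show j + 2 - 1 = j + 1 by omega]
  gcongr
  exact primeSeries_anti_left _ hy _ _

/-! ### First moments and the size of the boundary terms -/

/-- The first moment at `s = 1` of the series of the sifted `k`-almost primes. -/
noncomputable def firstMoment (y η : ℝ) (k : ℕ) : ℝ≥0∞ :=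
  ∫⁻ u in Ioc 0 η, ENNReal.ofReal u * almostPrimeSeries y k (1 + u)

theorem measurable_ofReal_mul_almostPrimeSeries (y : ℝ) (k : ℕ) :
    Measurable fun u : ℝ => ENNReal.ofReal u * almostPrimeSeries y k (1 + u) :=
  (measurable_id.ennreal_ofReal).mul (measurable_almostPrimeSeries y k)

theorem setLIntegral_mono_Ioc {η : ℝ} {f g : ℝ → ℝ≥0∞} (h : ∀ u, 0 < u → u ≤ η → f u ≤ g u) :
    ∫⁻ u in Ioc 0 η, f u ≤ ∫⁻ u in Ioc 0 η, g u :=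
  setLIntegral_mono' measurableSet_Ioc fun u hu => h u hu.1 hu.2

theorem firstMoment_eq (y : ℝ) (k : ℕ) {η : ℝ} (hη : 0 ≤ η) :
    firstMoment y η k = ENNReal.ofReal (η ^ 2 / 2) * almostPrimeSeries y k (1 + η) +
      ∑ i ∈ Finset.Icc 1 k, ∫⁻ u in Ioc 0 η, ENNReal.ofReal (u ^ 2 / 2) *
        (primeSeries logWeight y i (1 + u) * almostPrimeSeries y (k - i) (1 + u)) := by
  refine lintegral_almostPrimeSeries_by_parts y k hη (φ := fun u => u ^ 2 / 2) (ψ := fun u => u)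
    (fun u => ?_) continuous_id (by simp) (fun u _ => by positivity) (fun u hu => hu)
  have := (hasDerivAt_pow 2 u).div_const 2
  norm_num at this
  exact this

theorem lintegral_almostPrimeSeries_eq (y : ℝ) (k : ℕ) {η : ℝ} (hη : 0 ≤ η) :
    ∫⁻ u in Ioc 0 η, almostPrimeSeries y k (1 + u) =
      ENNReal.ofReal η * almostPrimeSeries y k (1 + η) +
      ∑ i ∈ Finset.Icc 1 k, ∫⁻ u in Ioc 0 η, ENNReal.ofReal u *
        (primeSeries logWeight y i (1 + u) * almostPrimeSeries y (k - i) (1 + u)) := by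
  have := lintegral_almostPrimeSeries_by_parts y k hη (φ := fun u => u) (ψ := fun _ => 1)
    (fun u => hasDerivAt_id u) continuous_const rfl (fun u hu => hu) (fun u _ => zero_le_one)
  simpa using this

theorem firstMoment_zero (y : ℝ) {η : ℝ} (hη : 0 ≤ η) :
    firstMoment y η 0 = ENNReal.ofReal (η ^ 2 / 2) := by
  rw [firstMoment_eq y 0 hη, almostPrimeSeries_zero]
  simp

theorem firstMoment_mono (y : ℝ) (k : ℕ) {η η' : ℝ} (h : η ≤ η') :
    firstMoment y η k ≤ firstMoment y η' k :=
  lintegral_mono_set (Ioc_subset_Ioc_right h)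

/-- Only the term i = 1 of `firstMoment_eq` is kept. Near u = 0 one has u T_1(1+u) ≥ 2/ρ, so (u²/2)
T_1(1+u) ≥ u/ρ. -/
theorem exists_firstMoment_le_mul_succ (y : ℝ) {ρ : ℝ} (hρ : 2 < ρ) : ∃ η₀ : ℝ, 0 < η₀ ∧
    ∀ η, 0 < η → η ≤ η₀ → ∀ k,
      firstMoment y η k ≤ ENNReal.ofReal ρ * firstMoment y η (k + 1) := by
  obtain ⟨C, hC, h⟩ := exists_one_le_mul_primeSeries_add y
  have hρ1 : 0 < 1 - 2 / ρ := by rw [sub_pos, div_lt_one (by linarith)]; exact hρ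
  refine ⟨min 1 ((1 - 2 / ρ) / C), lt_min one_pos (by positivity), fun η hη hη0 k => ?_⟩
  rw [firstMoment_eq y (k + 1) hη.le]
  calc firstMoment y η k ≤ ∫⁻ u in Ioc 0 η, ENNReal.ofReal ρ * (ENNReal.ofReal (u ^ 2 / 2) *
        (primeSeries logWeight y 1 (1 + u) * almostPrimeSeries y (k + 1 - 1) (1 + u))) := by
        refine setLIntegral_mono_Ioc fun u hu huη => ?_
        have hu0 := huη.trans hη0
        have hCu : C * u ≤ 1 - 2 / ρ := by
          have := hu0.trans (min_le_right _ _)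
          rw [le_div_iff₀ hC] at this
          linarith
        have h1 : ENNReal.ofReal (2 / ρ) ≤
            ENNReal.ofReal u * primeSeries logWeight y 1 (1 + u) := by
          have h2 : ENNReal.ofReal (2 / ρ) + ENNReal.ofReal (1 - 2 / ρ) ≤
              ENNReal.ofReal u * primeSeries logWeight y 1 (1 + u) +
                ENNReal.ofReal (1 - 2 / ρ) := by
            rw [← ENNReal.ofReal_add (by positivity) hρ1.le, add_sub_cancel, ENNReal.ofReal_one]
            refine (h u hu (hu0.trans (min_le_left _ _))).trans ?_
            gcongr
          exact (ENNReal.add_le_add_iff_right ENNReal.ofReal_ne_top).1 h2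
        calc ENNReal.ofReal u * almostPrimeSeries y k (1 + u)
            = ENNReal.ofReal (ρ * u / 2) * (ENNReal.ofReal (2 / ρ) *
                almostPrimeSeries y k (1 + u)) := by
              rw [← mul_assoc, ← ENNReal.ofReal_mul (by positivity)]
              congr 2
              field_simp
          _ ≤ ENNReal.ofReal (ρ * u / 2) * (ENNReal.ofReal u * primeSeries logWeight y 1 (1 + u) *
                almostPrimeSeries y k (1 + u)) := by gcongr
          _ = _ := by
              rw [← mul_assoc, ← mul_assoc, ← mul_assoc, ← mul_assoc,
                ← ENNReal.ofReal_mul (by positivity), ← ENNReal.ofReal_mul (by positivity)]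
              congr 3
              ring
    _ = ENNReal.ofReal ρ * ∫⁻ u in Ioc 0 η, ENNReal.ofReal (u ^ 2 / 2) *
        (primeSeries logWeight y 1 (1 + u) * almostPrimeSeries y (k + 1 - 1) (1 + u)) :=
        lintegral_const_mul' _ _ ENNReal.ofReal_ne_top
    _ ≤ _ := by
        gcongr
        refine le_add_left (Finset.single_le_sum (f := fun i => ∫⁻ u in Ioc 0 η,
          ENNReal.ofReal (u ^ 2 / 2) * (primeSeries logWeight y i (1 + u) *
            almostPrimeSeries y (k + 1 - i) (1 + u))) (fun _ _ => zero_le)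
          (Finset.mem_Icc.2 ⟨le_rfl, by omega⟩))

theorem firstMoment_le_pow_mul {y η : ℝ} {c : ℝ≥0∞}
    (h : ∀ k, firstMoment y η k ≤ c * firstMoment y η (k + 1)) (j i : ℕ) :
    firstMoment y η j ≤ c ^ i * firstMoment y η (j + i) := by
  induction i with
  | zero => simp
  | succ i ih =>
    refine ih.trans ?_
    rw [pow_succ, mul_assoc, ← add_assoc]
    gcongr
    exact h _

/-- Iterate the one-step comparison down to k = 0, where the moment is explicit; shrinking η to
reach its range of validity only lowers the moment. -/
theorem exists_le_firstMoment (y : ℝ) {ρ η : ℝ} (hρ : 2 < ρ) (hη : 0 < η) :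
    ∃ c : ℝ, 0 < c ∧ ∀ k, ENNReal.ofReal (c * ρ⁻¹ ^ k) ≤ firstMoment y η k := by
  obtain ⟨η₀, hη₀, h⟩ := exists_firstMoment_le_mul_succ y hρ
  have hm : 0 < min η η₀ := lt_min hη hη₀
  refine ⟨(min η η₀) ^ 2 / 2, by positivity, fun k => ?_⟩
  have h1 := firstMoment_le_pow_mul (h _ hm (min_le_right _ _)) 0 k
  rw [firstMoment_zero y hm.le, zero_add] at h1
  refine le_trans ?_ (firstMoment_mono y k (min_le_left η η₀))
  have hρ0 : 0 < ρ := by linarith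
  rw [inv_pow, ← div_eq_mul_inv, ENNReal.ofReal_div_of_pos (by positivity)]
  refine ENNReal.div_le_of_le_mul' ?_
  rwa [ENNReal.ofReal_pow hρ0.le]

theorem lintegral_almostPrimeSeries_lt_top {y : ℝ} (hy : 1 ≤ y) {η : ℝ} (hη : 0 < η)
    (hη1 : η ≤ 1) (k : ℕ) : ∫⁻ u in Ioc 0 η, almostPrimeSeries y k (1 + u) < ∞ := by
  obtain ⟨C, hC, hT⟩ := exists_mul_primeSeries_le hy
  induction k using Nat.strong_induction_on with
  | _ k ih =>
    rw [lintegral_almostPrimeSeries_eq y k hη.le]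
    have hD := almostPrimeSeries_lt_top y k (s := 1 + η) (by linarith)
    refine ENNReal.add_lt_top.2 ⟨by finiteness, ENNReal.sum_lt_top.2 fun i hi => ?_⟩
    have hi' := Finset.mem_Icc.1 hi
    calc _ ≤ ∫⁻ u in Ioc 0 η, C * almostPrimeSeries y (k - i) (1 + u) := by
          refine setLIntegral_mono_Ioc fun u hu huη => ?_
          rw [← mul_assoc]
          gcongr
          refine le_trans ?_ (hT u hu (huη.trans hη1))
          gcongr
          -- The trivial lower bound q = 1 gives T_i ≤ T_1, so u T_i(1+u) is bounded uniformly in i.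
          have := primeSeries_succ_le one_pos (y := y) (fun p hp => hp.1.one_le) logWeight 1 (i - 1)
            (s := 1 + u) (by linarith)
          rw [show 1 + (i - 1) = i by omega] at this
          simpa using this
      _ = C * ∫⁻ u in Ioc 0 η, almostPrimeSeries y (k - i) (1 + u) :=
          lintegral_const_mul' _ _ hC.ne
      _ < ∞ := ENNReal.mul_lt_top hC (ih _ (by omega))

theorem firstMoment_lt_top {y : ℝ} (hy : 1 ≤ y) {η : ℝ} (hη : 0 < η) (hη1 : η ≤ 1) (k : ℕ) :
    firstMoment y η k < ∞ := by
  refine lt_of_le_of_lt (setLIntegral_mono_Ioc fun u hu huη => ?_)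
    (lintegral_almostPrimeSeries_lt_top hy hη hη1 k)
  exact mul_le_of_le_one_left zero_le (ENNReal.ofReal_le_one.2 (huη.trans hη1))

theorem erdosENN_lt_top {y : ℝ} (hy : 1 ≤ y) {k : ℕ} (hk : 1 ≤ k) : erdosENN y k < ∞ := by
  have h1 := lintegral_almostPrimeSeries_lt_top hy one_pos le_rfl k
  have h2 := almostPrimeSeries_lt_top y k (s := 1 + 1) (by norm_num)
  exact (erdosENN_le_lintegral_add y hk zero_le_one).trans_lt (by finiteness)

theorem erdosTerm_nonneg (n : ℕ) : 0 ≤ erdosTerm n := by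
  have := Real.log_natCast_nonneg n
  unfold erdosTerm
  positivity

theorem summable_erdosTerm {y : ℝ} (hy : 1 ≤ y) {k : ℕ} (hk : 1 ≤ k) :
    Summable (fun n : siftedAlmostPrimes k y => erdosTerm (n : ℕ)) :=
  (ENNReal.summable_toReal (erdosENN_lt_top hy hk).ne).congr fun n =>
    ENNReal.toReal_ofReal (erdosTerm_nonneg n)

theorem siftedErdosSum_eq_toReal (k : ℕ) (y : ℝ) : siftedErdosSum k y = (erdosENN y k).toReal := by
  rw [erdosENN, ENNReal.tsum_toReal_eq fun n => ENNReal.ofReal_ne_top]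
  exact tsum_congr fun n => (ENNReal.toReal_ofReal (erdosTerm_nonneg n)).symm

theorem siftedAlmostPrimes_one (k : ℕ) : siftedAlmostPrimes k 1 = almostPrimes k := by
  ext n
  simp only [siftedAlmostPrimes, mem_ofPred_eq, and_iff_left_iff_imp]
  exact fun _ p hp _ => by exact_mod_cast hp.one_lt

theorem eventually_mul_inv_pow_lt {ρ z : ℝ} (hρ : 0 < ρ) (hz : ρ < z) (C : ℝ) {c : ℝ}
    (hc : 0 < c) : ∃ K : ℕ, ∀ k, K ≤ k → C * z⁻¹ ^ k < c * ρ⁻¹ ^ k := by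
  have hz0 : 0 < z := hρ.trans hz
  have h := tendsto_pow_atTop_nhds_zero_of_lt_one (r := ρ / z) (by positivity)
    ((div_lt_one hz0).2 hz)
  have h2 := (h.const_mul C).eventually (gt_mem_nhds (show C * 0 < c by simpa using hc))
  obtain ⟨K, hK⟩ := Filter.eventually_atTop.1 h2
  refine ⟨K, fun k hk => ?_⟩
  have h3 := hK k hk
  have h4 : C * z⁻¹ ^ k = C * (ρ / z) ^ k * ρ⁻¹ ^ k := by
    rw [mul_assoc, ← mul_pow]; congr 2; field_simp
  rw [h4]
  gcongr

/-- The series at `1 + η` decays faster than the first moments. -/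
theorem exists_mul_almostPrimeSeries_lt {x y : ℝ} {q : ℕ} (hq0 : 0 < q)
    (hq : ∀ p ∈ siftedPrimes x, q ≤ p) {η : ℝ} (hη : 0 < η) (hqη : 2 < (q : ℝ) ^ (1 + η))
    (j : ℕ) {B : ℝ} (hB : 0 < B) : ∃ K : ℕ, ∀ k, K ≤ k →
      ENNReal.ofReal B * almostPrimeSeries x (k + j) (1 + η) < firstMoment y η k := by
  -- With 2 < ρ < z < q^(1+η), the moments are at least of order ρ^(-k) and the series at most of
  -- order z^(-k).
  obtain ⟨ρ, hρ, hρq⟩ := exists_between hqη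
  obtain ⟨z, hz, hzq⟩ := exists_between hρq
  obtain ⟨C, hC, h1⟩ := exists_almostPrimeSeries_le hq0 hq (s := 1 + η) (by linarith)
    (z := z) (by linarith) hzq
  obtain ⟨c, hc, h2⟩ := exists_le_firstMoment y hρ hη
  obtain ⟨K, hK⟩ := eventually_mul_inv_pow_lt (by linarith) hz (B * C * z⁻¹ ^ j) hc
  refine ⟨K, fun k hk => ?_⟩
  calc _ ≤ ENNReal.ofReal B * ENNReal.ofReal (C * z⁻¹ ^ (k + j)) := by gcongr; exact h1 _
    _ = ENNReal.ofReal (B * C * z⁻¹ ^ j * z⁻¹ ^ k) := by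
        rw [← ENNReal.ofReal_mul hB.le, pow_add]; congr 1; ring
    _ < ENNReal.ofReal (c * ρ⁻¹ ^ k) := by
        have hρ0 : 0 < ρ := by linarith
        exact (ENNReal.ofReal_lt_ofReal_iff (by positivity)).2 (hK k hk)
    _ ≤ _ := h2 k

/-! ### Decrease of the sifted sums for y ≥ 2 -/

theorem sum_primeSeries_mul_firstMoment_le {y : ℝ} (hy : 2 ≤ y) {η : ℝ}
    (h : ∀ k, firstMoment y η k ≤ ENNReal.ofReal 2.01 * firstMoment y η (k + 1)) (k : ℕ) :
    ∑ i ∈ Finset.Icc 2 (k + 1), primeSeries logWeight y i 1 * firstMoment y η (k + 1 - i) ≤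
      ENNReal.ofReal (29 / 20) * firstMoment y η k := by
  calc _ ≤ ∑ i ∈ Finset.Icc 2 (k + 1), primeSeries logWeight y i 1 *
        ENNReal.ofReal 2.01 ^ (i - 1) * firstMoment y η k := by
        refine Finset.sum_le_sum fun i hi => ?_
        have hi' := Finset.mem_Icc.1 hi
        have := firstMoment_le_pow_mul h (k + 1 - i) (i - 1)
        rw [show k + 1 - i + (i - 1) = k by omega] at this
        rw [mul_assoc]
        gcongr
    _ ≤ _ := by
        rw [← Finset.sum_mul]
        gcongr
        exact sum_primeSeries_mul_pow_le hy _

theorem lintegral_mul_primeSeries_le {y η : ℝ} (i k : ℕ) :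
    ∫⁻ u in Ioc 0 η, ENNReal.ofReal u *
        (primeSeries logWeight y i (1 + u) * almostPrimeSeries y k (1 + u)) ≤
      primeSeries logWeight y i 1 * firstMoment y η k := by
  rw [firstMoment, ← lintegral_const_mul _ (measurable_ofReal_mul_almostPrimeSeries y k)]
  refine setLIntegral_mono_Ioc fun u hu _ => ?_
  rw [mul_left_comm]
  gcongr
  exact primeSeries_antitone _ _ _ (by linarith)

theorem sum_Icc_one_succ {M : Type*} [AddCommMonoid M] (f : ℕ → M) (k : ℕ) :
    ∑ i ∈ Finset.Icc 1 (k + 1), f i = f 1 + ∑ i ∈ Finset.Icc 2 (k + 1), f i := by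
  rw [← Finset.add_sum_Ioc_eq_sum_Icc (by omega : 1 ≤ k + 1)]
  rfl

/-- Both sums are compared with the same integral of u T_1 P_k: the k-th exceeds it by at least
(3/2) m_k, the next one by at most (29/20) m_k plus a negligible boundary term. -/
theorem eventually_erdosENN_succ_lt {y : ℝ} (hy : 2 ≤ y) : ∃ K : ℕ, ∀ k, K ≤ k →
    erdosENN y (k + 1) < erdosENN y k := by
  obtain ⟨η₁, hη₁, h₁⟩ := exists_firstMoment_le_mul_succ y (show (2 : ℝ) < 2.01 by norm_num)
  obtain ⟨η₂, hη₂, h₂⟩ := exists_primeSeries_add_le_inv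
  obtain ⟨η, hη, hη1, hηη₁, hηη₂⟩ : ∃ η : ℝ, 0 < η ∧ η ≤ 1 ∧ η ≤ η₁ ∧ η ≤ η₂ :=
    ⟨min 1 (min η₁ η₂), by positivity, min_le_left _ _, (min_le_right _ _).trans (min_le_left _ _),
      (min_le_right _ _).trans (min_le_right _ _)⟩
  have hm := h₁ η hη hηη₁
  have h3η : (2 : ℝ) < ((3 : ℕ) : ℝ) ^ (1 + η) := by
    calc (2 : ℝ) < 3 := by norm_num
      _ = (3 : ℝ) ^ (1 : ℝ) := by simp
      _ ≤ _ := by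
        push_cast
        exact Real.rpow_le_rpow_of_exponent_le (by norm_num) (by linarith)
  -- The boundary terms total at most 3 P_{k+1}(1+η), since η ≤ 1, and must stay below the gap (3/2
  -- - 29/20) m_k = m_k/20; hence 60 = 3 · 20.
  obtain ⟨K, hK⟩ := exists_mul_almostPrimeSeries_lt (y := y) (by norm_num)
    (siftedPrimes_three_le hy) hη h3η 1
    (B := 60) (by norm_num)
  refine ⟨K + 1, fun k hk => ?_⟩
  set m := firstMoment y η k
  have hmtop : m < ∞ := firstMoment_lt_top (by linarith) hη hη1 k
  have step : (∫⁻ u in Ioc 0 η, ENNReal.ofReal u *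
        (primeSeries logWeight y 1 (1 + u) * almostPrimeSeries y k (1 + u))) +
        ENNReal.ofReal (3 / 2) * m ≤ erdosENN y k := by
    refine le_trans ?_ (lintegral_almostPrimeSeries_le_erdosENN y (by omega) hη.le)
    have e : ENNReal.ofReal (3 / 2) * m = ∫⁻ u in Ioc 0 η, ENNReal.ofReal (3 / 2) *
        (ENNReal.ofReal u * almostPrimeSeries y k (1 + u)) :=
      (lintegral_const_mul' _ _ ENNReal.ofReal_ne_top).symm
    have hmeas : Measurable fun u : ℝ => ENNReal.ofReal (3 / 2) *
        (ENNReal.ofReal u * almostPrimeSeries y k (1 + u)) :=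
      (measurable_ofReal_mul_almostPrimeSeries y k).const_mul _
    rw [e, ← lintegral_add_right _ hmeas]
    refine setLIntegral_mono_Ioc fun u hu huη => ?_
    calc _ = ENNReal.ofReal u * (primeSeries logWeight y 1 (1 + u) + ENNReal.ofReal (3 / 2)) *
          almostPrimeSeries y k (1 + u) := by ring
      _ ≤ ENNReal.ofReal u * ENNReal.ofReal (1 / u) * almostPrimeSeries y k (1 + u) := by
          gcongr
          exact h₂ y hy u hu (huη.trans hηη₂)
      _ = _ := by
          rw [← ENNReal.ofReal_mul hu.le, mul_one_div_cancel hu.ne', ENNReal.ofReal_one, one_mul]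
  have upper : erdosENN y (k + 1) ≤ (∫⁻ u in Ioc 0 η, ENNReal.ofReal u *
      (primeSeries logWeight y 1 (1 + u) * almostPrimeSeries y k (1 + u))) +
      ENNReal.ofReal (29 / 20) * m + ENNReal.ofReal 3 * almostPrimeSeries y (k + 1) (1 + η) := by
    refine (erdosENN_le_lintegral_add y (by omega) hη.le).trans ?_
    rw [lintegral_almostPrimeSeries_eq y (k + 1) hη.le, sum_Icc_one_succ, Nat.add_sub_cancel]
    have e1 : ∑ i ∈ Finset.Icc 2 (k + 1), ∫⁻ u in Ioc 0 η, ENNReal.ofReal u *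
        (primeSeries logWeight y i (1 + u) * almostPrimeSeries y (k + 1 - i) (1 + u)) ≤
        ENNReal.ofReal (29 / 20) * m :=
      (Finset.sum_le_sum fun i _ => lintegral_mul_primeSeries_le i (k + 1 - i)).trans
        (sum_primeSeries_mul_firstMoment_le hy hm k)
    have e2 : ENNReal.ofReal η * almostPrimeSeries y (k + 1) (1 + η) ≤
        1 * almostPrimeSeries y (k + 1) (1 + η) := by
      gcongr
      exact ENNReal.ofReal_le_one.2 hη1
    calc _ ≤ 1 * almostPrimeSeries y (k + 1) (1 + η) + ((∫⁻ u in Ioc 0 η, ENNReal.ofReal u *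
          (primeSeries logWeight y 1 (1 + u) * almostPrimeSeries y k (1 + u))) +
          ENNReal.ofReal (29 / 20) * m) + 2 * almostPrimeSeries y (k + 1) (1 + η) := by gcongr
      _ = _ := by
        rw [ENNReal.ofReal_ofNat]
        ring
  have tail : ENNReal.ofReal (29 / 20) * m +
      ENNReal.ofReal 3 * almostPrimeSeries y (k + 1) (1 + η) < ENNReal.ofReal (3 / 2) * m := by
    have h5 := hK k (by omega)
    have h6 : ENNReal.ofReal 3 * almostPrimeSeries y (k + 1) (1 + η) <
        ENNReal.ofReal (1 / 20) * m := by
      rw [show (60 : ℝ) = 20 * 3 by norm_num, ENNReal.ofReal_mul (by norm_num), mul_assoc] at h5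
      rw [one_div, ENNReal.ofReal_inv_of_pos (by norm_num), ← ENNReal.div_eq_inv_mul,
        ENNReal.lt_div_iff_mul_lt (by simp) (by simp), mul_comm]
      exact h5
    calc _ < ENNReal.ofReal (29 / 20) * m + ENNReal.ofReal (1 / 20) * m :=
          ENNReal.add_lt_add_left (by finiteness) h6
      _ = _ := by
          rw [← add_mul, ← ENNReal.ofReal_add (by norm_num) (by norm_num)]
          norm_num
  set X := ∫⁻ u in Ioc 0 η, ENNReal.ofReal u *
    (primeSeries logWeight y 1 (1 + u) * almostPrimeSeries y k (1 + u))
  have hX : X ≠ ∞ := ne_top_of_le_ne_top (erdosENN_lt_top (by linarith) (by omega)).ne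
    (le_self_add.trans step)
  calc _ ≤ X + (ENNReal.ofReal (29 / 20) * m +
        ENNReal.ofReal 3 * almostPrimeSeries y (k + 1) (1 + η)) := by rwa [← add_assoc]
    _ < X + ENNReal.ofReal (3 / 2) * m := ENNReal.add_lt_add_left hX tail
    _ ≤ _ := step

/-! ### Near-halving of the sifted first moments -/

/-- In the formula for m_{k+1} the term i = 1 is at most m_k/2 because T_1(1+u) ≤ 1/u; the terms i ≥
2 carry an extra factor u ≤ η, and the boundary term is negligible for large k. -/
theorem exists_firstMoment_succ_le {y : ℝ} (hy : 2 ≤ y) {c : ℝ} (hc : 1 < c) :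
    ∃ η₀ : ℝ, 0 < η₀ ∧ ∀ η, 0 < η → η ≤ η₀ → ∃ K : ℕ, ∀ k, K ≤ k →
      firstMoment y η (k + 1) ≤ ENNReal.ofReal (c / 2) * firstMoment y η k := by
  obtain ⟨η₁, hη₁, h₁⟩ := exists_firstMoment_le_mul_succ y (show (2 : ℝ) < 2.01 by norm_num)
  obtain ⟨η₂, hη₂, h₂⟩ := exists_primeSeries_add_le_inv
  -- The slack c/2 - 1/2 equals 2δ: one δ for the boundary term, one for the terms i ≥ 2.
  set δ : ℝ := (c - 1) / 4 with hδ
  have hδ0 : 0 < δ := by rw [hδ]; linarith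
  refine ⟨min (min 1 δ) (min η₁ η₂), by positivity, fun η hη hη0 => ?_⟩
  have hη1 : η ≤ 1 := hη0.trans ((min_le_left _ _).trans (min_le_left _ _))
  have hηδ : η ≤ δ := hη0.trans ((min_le_left _ _).trans (min_le_right _ _))
  have hm := h₁ η hη (hη0.trans ((min_le_right _ _).trans (min_le_left _ _)))
  have hηη₂ : η ≤ η₂ := hη0.trans ((min_le_right _ _).trans (min_le_right _ _))
  have h2η : (2 : ℝ) < ((2 : ℕ) : ℝ) ^ (1 + η) := by
    calc (2 : ℝ) = (2 : ℝ) ^ (1 : ℝ) := by simp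
      _ < _ := by
        push_cast
        exact Real.rpow_lt_rpow_of_exponent_lt (by norm_num) (by linarith)
  obtain ⟨K, hK⟩ := exists_mul_almostPrimeSeries_lt (y := y) two_pos
    (siftedPrimes_two_le (y := y)) hη h2η 1 (B := 1 / δ) (by positivity)
  refine ⟨K, fun k hk => ?_⟩
  set m := firstMoment y η k with hmdef
  have b1 : ∫⁻ u in Ioc 0 η, ENNReal.ofReal (u ^ 2 / 2) *
      (primeSeries logWeight y 1 (1 + u) * almostPrimeSeries y k (1 + u)) ≤
      ENNReal.ofReal (1 / 2) * m := by
    rw [hmdef, firstMoment, ← lintegral_const_mul' _ _ ENNReal.ofReal_ne_top]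
    refine setLIntegral_mono_Ioc fun u hu huη => ?_
    calc _ ≤ ENNReal.ofReal (u ^ 2 / 2) * (ENNReal.ofReal (1 / u) *
          almostPrimeSeries y k (1 + u)) := by
          gcongr
          exact le_self_add.trans (h₂ y hy u hu (huη.trans hηη₂))
      _ = _ := by
          rw [← mul_assoc, ← mul_assoc, ← ENNReal.ofReal_mul (by positivity),
            ← ENNReal.ofReal_mul (by positivity)]
          congr 2
          field_simp
  have b2 : ∑ i ∈ Finset.Icc 2 (k + 1), ∫⁻ u in Ioc 0 η, ENNReal.ofReal (u ^ 2 / 2) *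
      (primeSeries logWeight y i (1 + u) * almostPrimeSeries y (k + 1 - i) (1 + u)) ≤
      ENNReal.ofReal (η / 2) * (ENNReal.ofReal (29 / 20) * m) := by
    refine le_trans ?_ (mul_le_mul_right (sum_primeSeries_mul_firstMoment_le hy hm k) _)
    rw [Finset.mul_sum]
    refine Finset.sum_le_sum fun i _ => ?_
    refine le_trans ?_ (mul_le_mul_right (lintegral_mul_primeSeries_le i (k + 1 - i)) _)
    rw [← lintegral_const_mul' _ _ ENNReal.ofReal_ne_top]
    refine setLIntegral_mono_Ioc fun u hu huη => ?_
    rw [← mul_assoc (ENNReal.ofReal (η / 2)), ← ENNReal.ofReal_mul (by positivity)]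
    gcongr
    nlinarith
  have b3 : ENNReal.ofReal (η ^ 2 / 2) * almostPrimeSeries y (k + 1) (1 + η) ≤
      ENNReal.ofReal δ * m := by
    calc _ ≤ ENNReal.ofReal (δ * (1 / δ)) * almostPrimeSeries y (k + 1) (1 + η) := by
          rw [mul_one_div_cancel hδ0.ne']
          gcongr
          nlinarith
      _ ≤ _ := by
          rw [ENNReal.ofReal_mul hδ0.le, mul_assoc]
          gcongr
          exact (hK k hk).le
  rw [firstMoment_eq y (k + 1) hη.le, sum_Icc_one_succ, Nat.add_sub_cancel]
  calc _ ≤ ENNReal.ofReal δ * m + (ENNReal.ofReal (1 / 2) * m +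
        ENNReal.ofReal (η / 2) * (ENNReal.ofReal (29 / 20) * m)) := by gcongr
    _ = ENNReal.ofReal (δ + (1 / 2 + η / 2 * (29 / 20))) * m := by
        rw [ENNReal.ofReal_add (by positivity) (by positivity),
          ENNReal.ofReal_add (by positivity) (by positivity), ENNReal.ofReal_mul (by positivity)]
        ring
    _ ≤ _ := by
        gcongr
        linarith

/-! ### Splitting by the power of 2 -/

theorem almostPrimeSeries_one_succ (k : ℕ) (s : ℝ) :
    almostPrimeSeries 1 (k + 1) s = almostPrimeSeries 2 (k + 1) s +
      ENNReal.ofReal ((2 : ℝ) ^ (-s)) * almostPrimeSeries 1 k s := by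
  set f : ℕ → ℝ≥0∞ := fun n => ENNReal.ofReal ((n : ℝ) ^ (-s)) with hf
  have h2 : 2 ∈ siftedPrimes 1 := ⟨Nat.prime_two, by norm_num⟩
  have hodd : ∀ n : ℕ, n ∈ siftedAlmostPrimes (k + 1) 2 ↔
      n ∈ siftedAlmostPrimes (k + 1) 1 ∧ ¬ 2 ^ 1 ∣ n := by
    intro n
    rw [pow_one]
    constructor
    · rintro ⟨h, h'⟩
      refine ⟨⟨h, fun p hp hpn => (by norm_num : (1 : ℝ) < 2).trans (h' p hp hpn)⟩, fun hd => ?_⟩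
      have := h' 2 Nat.prime_two hd
      norm_num at this
    · rintro ⟨⟨h, -⟩, hd⟩
      refine ⟨h, fun p hp hpn => ?_⟩
      have : p ≠ 2 := fun e => hd (e ▸ hpn)
      have h3 : 2 < p := lt_of_le_of_ne hp.two_le this.symm
      exact_mod_cast h3
  have hsplit : almostPrimeSeries 1 (k + 1) s =
      (∑' n : siftedAlmostPrimes (k + 1) 1, if ¬ 2 ^ 1 ∣ (n : ℕ) then f n else 0) +
      ∑' n : siftedAlmostPrimes (k + 1) 1, if 2 ^ 1 ∣ (n : ℕ) then f n else 0 := by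
    rw [← ENNReal.tsum_add]
    refine tsum_congr fun n => ?_
    by_cases h : 2 ^ 1 ∣ (n : ℕ)
    · rw [if_neg (not_not.2 h), if_pos h, zero_add]
    · rw [if_pos h, if_neg h, add_zero]
  rw [hsplit, tsum_sifted_dvd h2 (by omega) f, Nat.add_sub_cancel]
  congr 1
  · rw [tsum_subtype (siftedAlmostPrimes (k + 1) 1) (fun n => if ¬ 2 ^ 1 ∣ n then f n else 0),
      almostPrimeSeries, tsum_subtype (siftedAlmostPrimes (k + 1) 2) f]
    refine tsum_congr fun n => ?_
    by_cases h1 : n ∈ siftedAlmostPrimes (k + 1) 1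
    · rw [indicator_of_mem h1]
      by_cases hd : 2 ^ 1 ∣ n
      · rw [indicator_of_notMem fun h => ((hodd n).1 h).2 hd, if_neg (not_not.2 hd)]
      · rw [indicator_of_mem ((hodd n).2 ⟨h1, hd⟩), if_pos hd]
    · rw [indicator_of_notMem h1, indicator_of_notMem fun h => h1 ((hodd n).1 h).1]
  · rw [almostPrimeSeries, ← ENNReal.tsum_mul_left]
    refine tsum_congr fun m => ?_
    rw [← ENNReal.ofReal_mul (by positivity), hf]
    dsimp only
    rw [pow_one, Nat.cast_mul, Real.mul_rpow (by positivity) (by positivity)]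
    norm_num

theorem almostPrimeSeries_one_eq (n : ℕ) (s : ℝ) {j : ℕ} (hj : j ≤ n) :
    almostPrimeSeries 1 n s =
      ENNReal.ofReal ((2 : ℝ) ^ (-s)) ^ j * almostPrimeSeries 1 (n - j) s +
      ∑ l ∈ Finset.range j, ENNReal.ofReal ((2 : ℝ) ^ (-s)) ^ l * almostPrimeSeries 2 (n - l) s := by
  induction j with
  | zero => simp
  | succ j ih =>
    rw [ih (by omega), show n - j = n - (j + 1) + 1 by omega, almostPrimeSeries_one_succ,
      Finset.sum_range_succ, show n - (j + 1) + 1 = n - j by omega]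
    ring

/-- The contribution to the first moment of the integers with exactly `l` factors `2`. -/
noncomputable def dyadicMoment (y η : ℝ) (n l : ℕ) : ℝ≥0∞ :=
  ∫⁻ u in Ioc 0 η, ENNReal.ofReal u *
    (ENNReal.ofReal ((2 : ℝ) ^ (-(1 + u))) ^ l * almostPrimeSeries y (n - l) (1 + u))

theorem measurable_dyadicMoment_integrand (y : ℝ) (n l : ℕ) : Measurable fun u : ℝ =>
    ENNReal.ofReal u *
      (ENNReal.ofReal ((2 : ℝ) ^ (-(1 + u))) ^ l * almostPrimeSeries y (n - l) (1 + u)) := by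
  have := measurable_almostPrimeSeries y (n - l)
  fun_prop

/-- With sifting level 1 the dyadic moment collects the integers divisible by 2^j; with level 2 it
collects those divisible by 2 exactly l times. -/
theorem firstMoment_one_eq (η : ℝ) (n : ℕ) {j : ℕ} (hj : j ≤ n) :
    firstMoment 1 η n = dyadicMoment 1 η n j +
      ∑ l ∈ Finset.range j, dyadicMoment 2 η n l := by
  unfold dyadicMoment
  rw [← lintegral_finsetSum _ (fun l _ => measurable_dyadicMoment_integrand 2 n l),
    ← lintegral_add_left (measurable_dyadicMoment_integrand 1 n j)]
  refine lintegral_congr fun u => ?_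
  rw [almostPrimeSeries_one_eq n (1 + u) hj, mul_add, Finset.mul_sum]

theorem two_rpow_neg_one_add_le {u : ℝ} (hu : 0 ≤ u) : (2 : ℝ) ^ (-(1 + u)) ≤ 1 / 2 := by
  calc (2 : ℝ) ^ (-(1 + u)) ≤ (2 : ℝ) ^ (-1 : ℝ) :=
        Real.rpow_le_rpow_of_exponent_le (by norm_num) (by linarith)
    _ = _ := by rw [Real.rpow_neg_one]; norm_num

theorem dyadicMoment_le_firstMoment (y η : ℝ) (n l : ℕ) :
    dyadicMoment y η n l ≤ ENNReal.ofReal (1 / 2) ^ l * firstMoment y η (n - l) := by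
  rw [firstMoment, ← lintegral_const_mul' _ _ (by finiteness)]
  refine setLIntegral_mono_Ioc fun u hu _ => ?_
  rw [mul_left_comm]
  have := two_rpow_neg_one_add_le hu.le
  gcongr

theorem firstMoment_le_dyadicMoment (y η : ℝ) (n l : ℕ) :
    ENNReal.ofReal ((2 : ℝ) ^ (-(1 + η))) ^ l * firstMoment y η (n - l) ≤
      dyadicMoment y η n l := by
  rw [firstMoment, ← lintegral_const_mul' _ _ (by finiteness)]
  refine setLIntegral_mono_Ioc fun u hu huη => ?_
  rw [mul_left_comm]
  gcongr
  norm_num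

theorem half_pow_mul_le {N l l' : ℕ} (hN : 0 < N) (hl : l ≤ l') (hl' : l' ≤ N) {η : ℝ}
    (hη : η ≤ 1 / (2 * N)) :
    (1 / 2 : ℝ) ^ l * ((2 : ℝ) ^ (1 / (2 * N) : ℝ) / 2) ^ (l' - l) ≤
      2 * ((2 : ℝ) ^ (-(1 + η))) ^ l' := by
  have hN' : (0 : ℝ) < N := by exact_mod_cast hN
  have e1 : (1 / 2 : ℝ) = (2 : ℝ) ^ (-1 : ℝ) := by rw [Real.rpow_neg_one]; norm_num
  have e2 : (2 : ℝ) ^ (1 / (2 * N) : ℝ) / 2 = (2 : ℝ) ^ (1 / (2 * N) - 1 : ℝ) := by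
    rw [Real.rpow_sub_one (by norm_num)]
  have e3 : (2 : ℝ) * ((2 : ℝ) ^ (-(1 + η))) ^ l' = (2 : ℝ) ^ (1 + -(1 + η) * l') := by
    rw [Real.rpow_add (by norm_num), Real.rpow_one, Real.rpow_mul_natCast (by norm_num)]
  rw [e1, e2, e3, ← Real.rpow_mul_natCast (by norm_num), ← Real.rpow_mul_natCast (by norm_num),
    ← Real.rpow_add (by norm_num)]
  refine Real.rpow_le_rpow_of_exponent_le (by norm_num) ?_
  rw [Nat.cast_sub hl]
  have h1 : (l : ℝ) ≤ l' := by exact_mod_cast hl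
  have h2 : (l' : ℝ) ≤ N := by exact_mod_cast hl'
  have h3 : 1 / (2 * (N : ℝ)) * l' ≤ 1 / 2 := by
    rw [one_div_mul_eq_div, div_le_iff₀ (by positivity)]; linarith
  have h4 : η * l' ≤ 1 / 2 := le_trans (by gcongr) h3
  have h5 : 0 ≤ 1 / (2 * (N : ℝ)) * l := by positivity
  linarith

/-- One more factor 2 costs about 1/2, while removing one odd prime factor gains about 2 in the
sifted moment, so the groups are of comparable size over any bounded range of l. -/
theorem exists_dyadicMoment_le_two_mul {N : ℕ} (hN : 0 < N) : ∃ η₀ : ℝ, 0 < η₀ ∧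
    ∀ η, 0 < η → η ≤ η₀ → ∃ K : ℕ, ∀ n, K ≤ n → ∀ l l', l ≤ l' → l' ≤ N →
      dyadicMoment 2 η n l ≤ 2 * dyadicMoment 2 η n l' := by
  have hN' : (0 : ℝ) < N := by exact_mod_cast hN
  -- Over at most `N` steps the powers of `c` lose at most √2, and η ≤ 1/(2N) loses at most another
  -- √2 through 2^(-η l').
  set c : ℝ := (2 : ℝ) ^ (1 / (2 * N) : ℝ)
  have hc : 1 < c := Real.one_lt_rpow (by norm_num) (by positivity)
  obtain ⟨η₁, hη₁, h⟩ := exists_firstMoment_succ_le le_rfl hc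
  refine ⟨min η₁ (1 / (2 * N)), by positivity, fun η hη hη0 => ?_⟩
  obtain ⟨K, hK⟩ := h η hη (hη0.trans (min_le_left _ _))
  refine ⟨K + N, fun n hn l l' hl hl' => ?_⟩
  have iter : ∀ i, l + i ≤ N → firstMoment 2 η (n - l) ≤
      ENNReal.ofReal (c / 2) ^ i * firstMoment 2 η (n - (l + i)) := by
    intro i
    induction i with
    | zero => simp
    | succ i ih =>
      intro hi
      refine (ih (by omega)).trans ?_
      rw [pow_succ, mul_assoc]
      gcongr
      have := hK (n - (l + (i + 1))) (by omega)
      rwa [show n - (l + (i + 1)) + 1 = n - (l + i) by omega] at this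
  have h1 := iter (l' - l) (by omega)
  rw [show l + (l' - l) = l' by omega] at h1
  calc dyadicMoment 2 η n l ≤ ENNReal.ofReal (1 / 2) ^ l * firstMoment 2 η (n - l) :=
        dyadicMoment_le_firstMoment _ _ _ _
    _ ≤ ENNReal.ofReal (1 / 2) ^ l * (ENNReal.ofReal (c / 2) ^ (l' - l) *
        firstMoment 2 η (n - l')) := by gcongr
    _ = ENNReal.ofReal ((1 / 2) ^ l * (c / 2) ^ (l' - l)) * firstMoment 2 η (n - l') := by
        rw [ENNReal.ofReal_mul (by positivity), ENNReal.ofReal_pow (by positivity),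
          ENNReal.ofReal_pow (by positivity), mul_assoc]
    _ ≤ ENNReal.ofReal (2 * ((2 : ℝ) ^ (-(1 + η))) ^ l') * firstMoment 2 η (n - l') := by
        gcongr ENNReal.ofReal ?_ * _
        exact half_pow_mul_le hN hl hl' (hη0.trans (min_le_right _ _))
    _ = 2 * (ENNReal.ofReal ((2 : ℝ) ^ (-(1 + η))) ^ l' * firstMoment 2 η (n - l')) := by
        rw [ENNReal.ofReal_mul (by norm_num), ENNReal.ofReal_pow (by positivity), mul_assoc,
          ENNReal.ofReal_ofNat]
    _ ≤ _ := by gcongr; exact firstMoment_le_dyadicMoment _ _ _ _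

theorem exists_two_mul_sum_dyadicMoment_le {J : ℕ} (hJ : 0 < J) : ∃ η₀ : ℝ, 0 < η₀ ∧
    ∀ η, 0 < η → η ≤ η₀ → ∃ K : ℕ, ∀ n, K ≤ n →
      2 * ∑ l ∈ Finset.range J, dyadicMoment 2 η n l ≤ firstMoment 1 η n := by
  -- The first `J` groups are compared with the next 4`J`: being four times as many and smaller by
  -- at most a factor 2, these total at least twice as much.
  obtain ⟨η₀, hη₀, h⟩ := exists_dyadicMoment_le_two_mul (N := 5 * J) (by omega)
  refine ⟨η₀, hη₀, fun η hη hη0 => ?_⟩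
  obtain ⟨K, hK⟩ := h η hη hη0
  refine ⟨K + 5 * J, fun n hn => ?_⟩
  set B := ∑ l ∈ Finset.range J, dyadicMoment 2 η n l
  set A := ∑ l ∈ Finset.Ico J (5 * J), dyadicMoment 2 η n l
  have h1 : ∑ l ∈ Finset.range J, ∑ _l' ∈ Finset.Ico J (5 * J), dyadicMoment 2 η n l ≤
      ∑ _l ∈ Finset.range J, ∑ l' ∈ Finset.Ico J (5 * J), 2 * dyadicMoment 2 η n l' := by
    refine Finset.sum_le_sum fun l hl => Finset.sum_le_sum fun l' hl' => ?_
    have := Finset.mem_range.1 hl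
    have := Finset.mem_Ico.1 hl'
    exact hK n (by omega) l l' (by omega) (by omega)
  simp only [Finset.sum_const, ← Finset.mul_sum, Finset.card_range, Nat.card_Ico,
    ← Finset.smul_sum] at h1
  rw [nsmul_eq_mul, nsmul_eq_mul, show 5 * J - J = J * 4 by omega, Nat.cast_mul, mul_assoc,
    ENNReal.mul_le_mul_iff_right (by exact_mod_cast hJ.ne') (by finiteness)] at h1
  have h2 : 2 * (2 * B) ≤ 2 * A := by
    rw [← mul_assoc]
    convert h1 using 2
    norm_num
  rw [ENNReal.mul_le_mul_iff_right (by norm_num) (by norm_num)] at h2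
  refine h2.trans ?_
  rw [firstMoment_one_eq η n (j := 5 * J) (by omega), Finset.range_eq_Ico,
    ← Finset.sum_Ico_consecutive _ (Nat.zero_le J) (by omega : J ≤ 5 * J)]
  exact le_add_left (le_add_left le_rfl)

/-! ### Increase of the full sums -/

theorem lintegral_almostPrimeSeries_le_add {C η : ℝ} (hC : 0 ≤ C)
    (h : ∀ u, 0 < u → u ≤ η →
      1 ≤ ENNReal.ofReal u * primeSeries logWeight 1 1 (1 + u) + ENNReal.ofReal (C * u)) (n : ℕ) :
    ∫⁻ u in Ioc 0 η, almostPrimeSeries 1 n (1 + u) ≤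
      (∫⁻ u in Ioc 0 η, ENNReal.ofReal u *
        (primeSeries logWeight 1 1 (1 + u) * almostPrimeSeries 1 n (1 + u))) +
      ENNReal.ofReal C * firstMoment 1 η n := by
  have hmeas := (measurable_ofReal_mul_almostPrimeSeries 1 n).const_mul (ENNReal.ofReal C)
  rw [firstMoment, ← lintegral_const_mul' _ _ ENNReal.ofReal_ne_top, ← lintegral_add_right _ hmeas]
  refine setLIntegral_mono_Ioc fun u hu huη => ?_
  calc almostPrimeSeries 1 n (1 + u) = 1 * almostPrimeSeries 1 n (1 + u) := (one_mul _).symm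
    _ ≤ (ENNReal.ofReal u * primeSeries logWeight 1 1 (1 + u) + ENNReal.ofReal (C * u)) *
        almostPrimeSeries 1 n (1 + u) := by gcongr; exact h u hu huη
    _ = _ := by rw [ENNReal.ofReal_mul hC]; ring

/-- Keep only p = 2 in the prime sum. It has one more factor 2^(-(1+u)) than the dyadic moment, and
this is at least 1/4 because u ≤ 1. -/
theorem dyadicMoment_le_lintegral {η : ℝ} (hη1 : η ≤ 1) (n j : ℕ) :
    ENNReal.ofReal (Real.log 2 / 4) * dyadicMoment 1 η n (j + 1) ≤
      ∫⁻ u in Ioc 0 η, ENNReal.ofReal u * (primeSeries logWeight 1 (j + 2) (1 + u) *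
        almostPrimeSeries 1 (n - (j + 1)) (1 + u)) := by
  rw [dyadicMoment, ← lintegral_const_mul' _ _ ENNReal.ofReal_ne_top]
  refine setLIntegral_mono_Ioc fun u hu huη => ?_
  rw [mul_left_comm, ← mul_assoc (ENNReal.ofReal (Real.log 2 / 4))]
  gcongr
  set r := ENNReal.ofReal ((2 : ℝ) ^ (-(1 + u))) with hr
  have hlog : 0 ≤ Real.log 2 := Real.log_nonneg (by norm_num)
  have h1 : ENNReal.ofReal (1 / 4) ≤ r := by
    refine ENNReal.ofReal_le_ofReal ?_
    calc (1 / 4 : ℝ) = (2 : ℝ) ^ (-2 : ℝ) := by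
          rw [Real.rpow_neg (by norm_num), Real.rpow_ofNat]; norm_num
      _ ≤ _ := Real.rpow_le_rpow_of_exponent_le (by norm_num) (by linarith)
  calc ENNReal.ofReal (Real.log 2 / 4) * r ^ (j + 1)
      = ENNReal.ofReal (Real.log 2) * (ENNReal.ofReal (1 / 4) * r ^ (j + 1)) := by
        rw [div_eq_mul_one_div, ENNReal.ofReal_mul hlog, mul_assoc]
    _ ≤ ENNReal.ofReal (Real.log 2) * (r * r ^ (j + 1)) := by gcongr
    _ = logWeight 2 * ENNReal.ofReal (((2 : ℕ) : ℝ) ^ (-(1 + u))) ^ (j + 2) := by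
        rw [← pow_succ', hr, logWeight]
        push_cast
        rfl
    _ ≤ _ := ENNReal.le_tsum (f := fun p : siftedPrimes 1 =>
        logWeight p * ENNReal.ofReal (((p : ℕ) : ℝ) ^ (-(1 + u))) ^ (j + 2))
        ⟨2, Nat.prime_two, by norm_num⟩

theorem lintegral_add_sum_dyadicMoment_le {η : ℝ} (hη : 0 ≤ η) (hη1 : η ≤ 1) {n J : ℕ}
    (hJ : J ≤ n) :
    (∫⁻ u in Ioc 0 η, ENNReal.ofReal u *
      (primeSeries logWeight 1 1 (1 + u) * almostPrimeSeries 1 n (1 + u))) +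
      ENNReal.ofReal (Real.log 2 / 4) * ∑ j ∈ Finset.range J, dyadicMoment 1 η n (j + 1) ≤
      erdosENN 1 (n + 1) := by
  refine le_trans ?_ (lintegral_almostPrimeSeries_le_erdosENN 1 (by omega) hη)
  rw [lintegral_almostPrimeSeries_eq 1 (n + 1) hη]
  refine le_add_left ?_
  rw [← Finset.Ico_add_one_right_eq_Icc, Finset.sum_Ico_eq_sum_range, Nat.add_sub_cancel,
    Finset.sum_range_succ', add_comm]
  refine add_le_add ?_ (by simp)
  rw [Finset.mul_sum]
  refine (Finset.sum_le_sum fun j _ => dyadicMoment_le_lintegral hη1 n j).trans ?_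
  refine le_trans (Finset.sum_le_sum_of_subset (Finset.range_mono hJ)) ?_
  refine Finset.sum_le_sum fun j _ => ?_
  rw [show 1 + (j + 1) = j + 2 by omega, show n + 1 - (j + 2) = n - (j + 1) by omega]

/-- Relative to the integral of u T_1 P_n, the n-th sum is larger by at most (C + 1) m_n, boundary
included, while the next one gains (log 2 / 4) times `J` dyadic moments, each at least m_n/2. -/
theorem eventually_erdosENN_one_lt_succ : ∃ K : ℕ, ∀ n, K ≤ n →
    erdosENN 1 n < erdosENN 1 (n + 1) := by
  obtain ⟨C, hC, hT⟩ := exists_one_le_mul_primeSeries_add 1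
  have hlog : 0 < Real.log 2 := Real.log_pos (by norm_num)
  -- Chosen so that (log 2 / 4) · (J/2) exceeds C + 1, where the 1 pays for the boundary term.
  obtain ⟨J, hJ⟩ := exists_nat_gt (8 * (C + 1) / Real.log 2)
  have hJ0 : 0 < J := by
    have : (0 : ℝ) < J := lt_trans (by positivity) hJ
    exact_mod_cast this
  rw [div_lt_iff₀ hlog] at hJ
  obtain ⟨η₀, hη₀, hD⟩ := exists_two_mul_sum_dyadicMoment_le hJ0
  obtain ⟨η, hη, hη1, hηη₀⟩ : ∃ η : ℝ, 0 < η ∧ η ≤ 1 ∧ η ≤ η₀ :=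
    ⟨min 1 η₀, by positivity, min_le_left _ _, min_le_right _ _⟩
  obtain ⟨K₁, hK₁⟩ := hD η hη hηη₀
  have h2η : (2 : ℝ) < ((2 : ℕ) : ℝ) ^ (1 + η) := by
    calc (2 : ℝ) = (2 : ℝ) ^ (1 : ℝ) := by simp
      _ < _ := by
        push_cast
        exact Real.rpow_lt_rpow_of_exponent_lt (by norm_num) (by linarith)
  obtain ⟨K₂, hK₂⟩ := exists_mul_almostPrimeSeries_lt (x := 1) (y := 2) two_pos
    siftedPrimes_two_le hη h2η 0 (B := 2) (by norm_num)
  refine ⟨K₁ + K₂ + J + 1, fun n hn => ?_⟩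
  set A := firstMoment 1 η n with hA
  set W := ∑ j ∈ Finset.range J, dyadicMoment 1 η n (j + 1)
  set B := ∑ l ∈ Finset.range J, dyadicMoment 2 η n l
  set X := ∫⁻ u in Ioc 0 η, ENNReal.ofReal u *
      (primeSeries logWeight 1 1 (1 + u) * almostPrimeSeries 1 n (1 + u))
  set t := 2 * almostPrimeSeries 1 n (1 + η)
  have hAtop : A ≠ ∞ := (firstMoment_lt_top le_rfl hη hη1 n).ne
  have hB : 2 * B ≤ A := hK₁ n (by omega)
  have low : X + ENNReal.ofReal (Real.log 2 / 4) * W ≤ erdosENN 1 (n + 1) :=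
    lintegral_add_sum_dyadicMoment_le hη.le hη1 (by omega)
  have upp : erdosENN 1 n ≤ X + ENNReal.ofReal C * A + t := by
    refine (erdosENN_le_lintegral_add 1 (by omega) hη.le).trans ?_
    gcongr
    exact lintegral_almostPrimeSeries_le_add hC.le (fun u hu huη => hT u hu (huη.trans hη1)) n
  have htA : t < A := by
    have h1 := hK₂ n (by omega)
    rw [ENNReal.ofReal_ofNat] at h1
    refine h1.trans_le ?_
    rw [hA, firstMoment_one_eq η n (j := 1) (by omega), Finset.sum_range_one]
    refine le_add_left (le_of_eq ?_)
    simp [dyadicMoment, firstMoment]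
  -- For each j < `J`, the integers with at most j factors 2 contribute at most `B` ≤ `A`/2, so
  -- those divisible by 2^(j+1) contribute the other half. Doubling before cancelling avoids
  -- subtraction.
  have hWA : (J : ℝ≥0∞) * A ≤ 2 * W := by
    have h1 : (J : ℝ≥0∞) * A ≤ W + J * B := by
      calc (J : ℝ≥0∞) * A = ∑ _j ∈ Finset.range J, A := by simp
        _ ≤ ∑ j ∈ Finset.range J, (dyadicMoment 1 η n (j + 1) + B) := by
          refine Finset.sum_le_sum fun j hj => ?_
          have hj' := Finset.mem_range.1 hj
          rw [hA, firstMoment_one_eq η n (j := j + 1) (by omega)]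
          gcongr
          exact Finset.sum_le_sum_of_subset (Finset.range_mono (by omega))
        _ = _ := by rw [Finset.sum_add_distrib]; simp [W]
    have h2 : (J : ℝ≥0∞) * A + J * A ≤ 2 * W + J * A := by
      calc _ = 2 * (J * A) := by ring
        _ ≤ 2 * (W + J * B) := by gcongr
        _ = 2 * W + J * (2 * B) := by ring
        _ ≤ _ := by gcongr
    exact (ENNReal.add_le_add_iff_right (by finiteness)).1 h2
  have hX : X ≠ ∞ := ne_top_of_le_ne_top (erdosENN_lt_top le_rfl (by omega)).ne
    (le_self_add.trans low)
  have main : ENNReal.ofReal (C + 1) * A ≤ ENNReal.ofReal (Real.log 2 / 4) * W := by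
    calc ENNReal.ofReal (C + 1) * A ≤ ENNReal.ofReal (Real.log 2 / 8 * J) * A := by
          gcongr
          linarith
      _ = ENNReal.ofReal (Real.log 2 / 8) * (J * A) := by
          rw [ENNReal.ofReal_mul (by positivity), ENNReal.ofReal_natCast, mul_assoc]
      _ ≤ ENNReal.ofReal (Real.log 2 / 8) * (2 * W) := by gcongr
      _ = _ := by
          rw [show Real.log 2 / 4 = Real.log 2 / 8 * 2 by ring, ENNReal.ofReal_mul (by positivity),
            ENNReal.ofReal_ofNat, mul_assoc]
  calc erdosENN 1 n ≤ X + ENNReal.ofReal C * A + t := upp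
    _ < X + ENNReal.ofReal C * A + A := ENNReal.add_lt_add_left (by finiteness) htA
    _ = X + ENNReal.ofReal (C + 1) * A := by
        rw [ENNReal.ofReal_add hC.le zero_le_one, ENNReal.ofReal_one]; ring
    _ ≤ X + ENNReal.ofReal (Real.log 2 / 4) * W := by gcongr
    _ ≤ _ := low

theorem theorem1 :
    ((∀ k : ℕ, 1 ≤ k → Summable (fun n : almostPrimes k => erdosTerm (n : ℕ))) ∧
      ∃ K : ℕ, 2 ≤ K ∧ ∀ k : ℕ, K ≤ k → erdosSum (k - 1) < erdosSum k) ∧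
    (∀ y : ℝ, 2 ≤ y →
      (∀ k : ℕ, 1 ≤ k → Summable (fun n : siftedAlmostPrimes k y => erdosTerm (n : ℕ))) ∧
      ∃ K : ℕ, 2 ≤ K ∧ ∀ k : ℕ, K ≤ k →
        siftedErdosSum (k - 1) y > siftedErdosSum k y) := by
  have hsum : ∀ k, erdosSum k = siftedErdosSum k 1 := fun k => by
    rw [siftedErdosSum, siftedAlmostPrimes_one, erdosSum]
  refine ⟨⟨fun k hk => ?_, ?_⟩, fun y hy =>
    ⟨fun k hk => summable_erdosTerm (by linarith) hk, ?_⟩⟩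
  · have := summable_erdosTerm le_rfl hk
    rwa [siftedAlmostPrimes_one] at this
  · obtain ⟨K, hK⟩ := eventually_erdosENN_one_lt_succ
    refine ⟨K + 2, by omega, fun k hk => ?_⟩
    have h := hK (k - 1) (by omega)
    rw [Nat.sub_add_cancel (by omega)] at h
    rw [hsum, hsum, siftedErdosSum_eq_toReal, siftedErdosSum_eq_toReal]
    exact ENNReal.toReal_strict_mono (erdosENN_lt_top le_rfl (by omega)).ne h
  · obtain ⟨K, hK⟩ := eventually_erdosENN_succ_lt hy
    refine ⟨K + 2, by omega, fun k hk => ?_⟩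
    have h := hK (k - 1) (by omega)
    rw [Nat.sub_add_cancel (by omega)] at h
    rw [siftedErdosSum_eq_toReal, siftedErdosSum_eq_toReal]
    exact ENNReal.toReal_strict_mono (erdosENN_lt_top (by linarith) (by omega)).ne h
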